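/- Let $s>r\ge 2$ be integers. The semi-random hypergraph process on $[n]$ (with $n\ge s$) starts from the empty hypergraph $H_0$. In step $t\ge1$ a uniformly random $r$-subset $U_t$ of $[n]$ is drawn, independently of the past. The player, who knows the history and $U_t$, then selects, possibly at random, an $(s-r)$-subset $V_t$ of $[n]$, and the edge $U_t\cup V_t$ (as a multiset; $U_t$ and $V_t$ may overlap and edges may be repeated) is added to $H_{t-1}$ to form $H_t$. A strategy $\mathcal S$ on $[n]$ prescribes, for each history and each $U_t$, the distribution of $V_t$. For an $s$-graph $G$ (a finite hypergraph all of whose edges are $s$-sets) let $\mathcal P_G$ be the property of containing a copy of $G$. For $0<q<1$ let $\tau^{(r)}_{\mathcal P_G}(\mathcal S,q,n)$ be the least $t\ge 0$ with $\mathbb P[H_t\in\mathcal P_G]\ge q$ ($\infty$ if there is none), let $\tau^{(r)}_{\mathcal P_G}(q,n)=\inf_{\mathcal S}\tau^{(r)}_{\mathcal P_G}(\mathcal S,q,n)$, and let $$\tau^{(r)}_{\mathcal P_G}=\lim_{q\to1^-}\limsup_{n\to\infty}\frac{\ln \tau^{(r)}_{\mathcal P_G}(q,n)}{\ln n}\in[-\infty,\infty],\qquad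 \ln 0=-\infty,\ \ln\infty=\infty.$$ **Corollary.** Let $G$ be any $s$-graph. Let $\Delta_{s-r}(G)$ be the maximum, over all sets $D$ of $s-r$ vertices of $G$, of the number of edges of $G$ containing $D$ ($0$ if $G$ has fewer than $s-r$ vertices), and let $\ell=e(G)-\Delta_{s-r}(G)$. Then there is a least integer $k>s$ with $k\ge |V(G)|$ and $$\ell\le\frac{r\binom{k-s+r}{r}-(k-s+r)}{k-s},$$ and for this $k$ $$\tau^{(r)}_{\mathcal P_G}\le r-\frac{k-s+r}{\binom{k-s+r}{r}+\ell}.$$ In particular, $\tau^{(r)}_{\mathcal P_G}<r$ for every $s$-graph $G$. -/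

import Mathlib

open Filter Topology
open scoped ENNReal

namespace SemiRandom

/-! ### The semi-random hypergraph process -/

/-- One round of the process on `[n]`: the random `r`-set `U` together with the player's
`(s - r)`-set `V`. The two sets may overlap. -/
abbrev Round (r s n : ℕ) : Type :=
  Set.powersetCard (Fin n) r × Set.powersetCard (Fin n) (s - r)

/-- A (possibly randomised) strategy on `[n]`: given the history of the previous rounds (listed
with the most recent one first; its length determines the current time) and the current random
`r`-set, it returns the distribution of the `(s - r)`-set that the player selects. -/
abbrev Strategy (r s n : ℕ) : Type :=
  List (Round r s n) → Set.powersetCard (Fin n) r → PMF (Set.powersetCard (Fin n) (s - r))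

theorem powersetCard_nonempty {r n : ℕ} (h : r ≤ n) : Nonempty (Set.powersetCard (Fin n) r) := by
  obtain ⟨A, -, hA⟩ := Finset.exists_subset_card_eq
    (s := (Finset.univ : Finset (Fin n))) (n := r) (by simpa using h)
  exact ⟨⟨A, hA⟩⟩

open scoped Classical in
/-- The uniform distribution on the `r`-subsets of `[n]`. -/
noncomputable def uniformSet {r n : ℕ} (h : r ≤ n) : PMF (Set.powersetCard (Fin n) r) :=
  haveI := powersetCard_nonempty h
  PMF.uniformOfFintype (Set.powersetCard (Fin n) r)

/-- The law of the history of the first `t` rounds when the player follows `S`: in each round `U`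
is uniform and independent of the past, and then `V` is drawn from the distribution given by
`S`. -/
noncomputable def historyLaw {r s n : ℕ} (h : r ≤ n) (S : Strategy r s n) :
    ℕ → PMF (List (Round r s n))
  | 0 => PMF.pure []
  | t + 1 => (historyLaw h S t).bind fun past =>
      (uniformSet h).bind fun U => (S past U).map fun V => (U, V) :: past

/-- A finite multi-hypergraph on `[n]`: a multiset of edges, each edge being a multiset of
vertices. -/
abbrev MultiHypergraph (n : ℕ) : Type := Multiset (Multiset (Fin n))

/-- The multi-hypergraph built along a history: every round `(U, V)` contributes the edge which is
the union of `U` and `V` as multisets, so it has exactly `r + (s - r)` elements with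
multiplicity. -/
def built {r s n : ℕ} (past : List (Round r s n)) : MultiHypergraph n :=
  (past.map fun R => R.1.1.val + R.2.1.val : List (Multiset (Fin n)))

/-- The law of the random multi-hypergraph `H_t` under the strategy `S`. -/
noncomputable def processLaw {r s n : ℕ} (h : r ≤ n) (S : Strategy r s n) (t : ℕ) :
    PMF (MultiHypergraph n) :=
  (historyLaw h S t).map built

/-! ### Thresholds -/

/-- A property of multi-hypergraphs on the vertex sets `[n]`. -/
abbrev HProperty : Type := ∀ n : ℕ, MultiHypergraph n → Prop

/-- `τ_P(S, q, n)`: the least `t` with `ℙ[H_t ∈ P] ≥ q`, and `∞` if there is none. -/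
noncomputable def strategyTime {r s n : ℕ} (P : HProperty) (h : r ≤ n) (S : Strategy r s n)
    (q : ℝ) : ℕ∞ :=
  ⨅ (t : ℕ) (_ : ENNReal.ofReal q ≤ (processLaw h S t).toOuterMeasure {H | P n H}), (t : ℕ∞)

/-- `τ_P(q, n)`: the infimum of `τ_P(S, q, n)` over all strategies on `[n]` (it is `∞` for the
finitely many `n < s`, where the process need not be defined). -/
noncomputable def optimalTime (r s : ℕ) (P : HProperty) (q : ℝ) (n : ℕ) : ℕ∞ :=
  if h : r ≤ n ∧ s ≤ n then ⨅ S : Strategy r s n, strategyTime P h.1 S q else ⊤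

/-- `limsup_{n → ∞} ln τ_P(q, n) / ln n`, in the extended reals (`ln 0 = -∞`, `ln ∞ = ∞`). -/
noncomputable def exponentAt (r s : ℕ) (P : HProperty) (q : ℝ) : EReal :=
  limsup (fun n : ℕ =>
    ENNReal.log (optimalTime r s P q n : ℝ≥0∞) / ((Real.log (n : ℝ) : ℝ) : EReal)) atTop

/-- `τ_P`: the limit of `exponentAt` as `q → 1⁻`. -/
noncomputable def tau (r s : ℕ) (P : HProperty) : EReal :=
  limUnder (𝓝[<] (1 : ℝ)) (exponentAt r s P)

theorem optimalTime_mono (r s : ℕ) (P : HProperty) (n : ℕ) :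
    Monotone fun q : ℝ => optimalTime r s P q n := by
  intro q₁ q₂ hq
  unfold optimalTime
  dsimp only
  split_ifs with h
  · refine iInf_mono fun S => iInf_mono fun t => ?_
    exact iInf_mono' fun ht => ⟨(ENNReal.ofReal_le_ofReal hq).trans ht, le_rfl⟩
  · exact le_rfl

theorem exponentAt_mono (r s : ℕ) (P : HProperty) : Monotone (exponentAt r s P) := by
  intro q₁ q₂ hq
  refine limsup_le_limsup (Eventually.of_forall fun n => ?_)
  refine EReal.div_le_div_right_of_nonneg ?_ ?_
  · exact_mod_cast Real.log_natCast_nonneg n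
  · exact ENNReal.log_monotone (by exact_mod_cast optimalTime_mono r s P n hq)

/-- The limit which defines `tau` exists. -/
theorem tendsto_tau (r s : ℕ) (P : HProperty) :
    Tendsto (exponentAt r s P) (𝓝[<] (1 : ℝ)) (𝓝 (tau r s P)) :=
  tendsto_nhds_limUnder ⟨_, (exponentAt_mono r s P).tendsto_nhdsLT 1⟩

/-! ### Fixed subhypergraphs -/

/-- `G` is an `s`-graph: a hypergraph with finitely many vertices all of whose edges are `s`-sets. -/
def IsSGraph {α : Type*} (G : Hypergraph α) (s : ℕ) : Prop :=
  G.vertexSet.Finite ∧ ∀ e ∈ G.edgeSet, e.ncard = s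

/-- The property `P_G` of containing a copy of `G`: some injection of the vertices of `G` into `[n]`
sends each edge of `G` to a (non-degenerate) edge of `H`. -/
def containsCopy {α : Type*} (G : Hypergraph α) : HProperty := fun n H =>
  ∃ φ : G.vertexSet → Fin n, Function.Injective φ ∧
    ∀ e ∈ G.edgeSet, ∃ F ∈ H, F.Nodup ∧ ∀ x : Fin n, x ∈ F ↔ ∃ v, v.1 ∈ e ∧ φ v = x

/-- `Δ_d(G)`: the maximum, over all `d`-sets `D` of vertices, of the number of edges which
contain `D` (and `0` if `G` has fewer than `d` vertices). -/
noncomputable def maxDegree {α : Type*} (G : Hypergraph α) (d : ℕ) : ℕ :=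
  sSup {m | ∃ D ⊆ G.vertexSet, D.ncard = d ∧ m = {e ∈ G.edgeSet | D ⊆ e}.ncard}

/-- `ℓ = e(G) - Δ_{s-r}(G)`; the subtraction does not truncate when `G` is finite. -/
noncomputable def surplus {α : Type*} (G : Hypergraph α) (r s : ℕ) : ℕ :=
  G.edgeSet.ncard - maxDegree G (s - r)

/-- The condition `ℓ ≤ (r * C(k-s+r, r) - (k-s+r)) / (k-s)` on the excess, for `k > s`. -/
def ExcessCondition (r s ℓ k : ℕ) : Prop :=
  s < k ∧ (ℓ : ℝ) ≤
    ((r : ℝ) * ((k - s + r).choose r : ℝ) - ((k : ℝ) - s + r)) / ((k : ℝ) - s)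

end SemiRandom

namespace SemiRandom

/-! ### Hits of independent uniform draws and the second moment method. -/

section Probability

open scoped BigOperators Classical
open Finset

/-! Put `m = k - s + r` and `d = s - r`, and let `D` be a `d`-set of maximum degree. Fix `d` common
vertices of `[n]`, to play `D`, and `m` disjoint blocks of `w ≈ n / m` vertices. A candidate picks
one vertex from each block. An edge containing `D` appears once its other `r` vertices are drawn and
the player answers with the common vertices. The player therefore first spends `T₁` rounds on each
`r`-subset of `[m]`, always giving this answer. Then `T₂` rounds go to each of the `l` surplus
edges: if the drawn set is the required part of that edge for some candidate whose `C(m, r)` targets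
have all been hit, the player completes the edge for such a candidate. This works if some candidate
has all its targets hit and no rival shares one of its surplus targets (`Good`,
`mem_history_player`).

If a round hits its target with probability such that a role succeeds with probability `q₁ ≈ n^(-a)`
or `q₂ ≈ n^(-b)`, then the number of fully hit candidates is concentrated as soon as `a * C(j, r) +
b * l < j` for `r ≤ j ≤ m`. Rivals are negligible if `m - j < a * (C(m, r) - C(j, r))` for `r ≤ j <
m` (`expect_not_good`). The cost is of order at most `n^(r - min a b)` (`exponentAt_le`).

With `θ = m / (C(m, r) + l)`, convexity of `C(j, r)` (`choose_chord`) reduces `θ * (C(j, r) + l) ≤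
j` to the ends of the range: `j = m` gives equality, and `j = r` is exactly the excess condition.
Taking `a` slightly above and `b` slightly below `θ` meets both requirements when `l > 0`; without
surplus edges there are no rivals, and both go slightly below `θ` (`tau_le_of_blueprint`). -/

theorem expect_pi_prod {ρ : Type*} [Fintype ρ] [DecidableEq ρ] {A : ρ → Type*} [∀ i, Fintype (A i)]
    (g : ∀ i, A i → ℝ) :
    𝔼 ω : ∀ i, A i, ∏ i, g i (ω i) = ∏ i, 𝔼 a, g i a := by
  simp only [Fintype.expect_eq_sum_div_card]
  rw [Finset.prod_div_distrib, Finset.prod_univ_sum, Fintype.card_pi]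
  simp [Fintype.piFinset_univ]

/-- The indicator that the value `x` is taken by `ω`. -/
noncomputable def hit {ι R : Type*} (ω : ι → R) (x : R) : ℝ := if x ∈ Set.range ω then 1 else 0

/-- The probability that a given element is drawn in `T` uniform draws from `N` elements. -/
noncomputable def hitProb (N T : ℕ) : ℝ := 1 - (1 - 1 / (N : ℝ)) ^ T

theorem hit_nonneg {ι R : Type*} (ω : ι → R) (x : R) : 0 ≤ hit ω x := by
  unfold hit; split_ifs <;> norm_num

theorem hit_mul_self {ι R : Type*} (ω : ι → R) (x : R) : hit ω x * hit ω x = hit ω x := by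
  unfold hit; split_ifs <;> norm_num

theorem expect_miss {R : Type*} [Fintype R] (T : ℕ) (B : Finset R) [Nonempty R] :
    𝔼 ω : Fin T → R, (if ∀ j, ω j ∉ B then (1 : ℝ) else 0) =
      (1 - (B.card : ℝ) / Fintype.card R) ^ T := by
  have h1 : ∀ ω : Fin T → R, (if ∀ j, ω j ∉ B then (1 : ℝ) else 0) =
      ∏ j, (if ω j ∉ B then (1 : ℝ) else 0) := by
    intro ω
    rw [Finset.prod_ite_zero]
    simp
  simp_rw [h1]
  rw [expect_pi_prod (fun (_ : Fin T) (a : R) => if a ∉ B then (1 : ℝ) else 0)]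
  rw [Finset.prod_const, Finset.card_univ, Fintype.card_fin]
  congr 1
  rw [Fintype.expect_eq_sum_div_card, Finset.sum_boole]
  have h2 : (Finset.univ.filter fun a => a ∉ B) = Bᶜ := by ext; simp
  have hN : (Fintype.card R : ℝ) ≠ 0 := by exact_mod_cast Fintype.card_ne_zero
  rw [h2, Finset.card_compl, Nat.cast_sub (Finset.card_le_univ _)]
  field_simp

theorem hit_eq {R : Type*} {T : ℕ} (ω : Fin T → R) (x : R) :
    hit ω x = 1 - (if ∀ j, ω j ∉ ({x} : Finset R) then (1 : ℝ) else 0) := by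
  unfold hit
  by_cases h : x ∈ Set.range ω
  · rw [if_pos h, if_neg]
    · norm_num
    · obtain ⟨j, hj⟩ := h
      simpa using ⟨j, hj⟩
  · rw [if_neg h, if_pos]
    · norm_num
    · intro j
      simpa using fun hj => h ⟨j, hj⟩

theorem expect_hit {R : Type*} [Fintype R] (T : ℕ) (x : R) :
    𝔼 ω : Fin T → R, hit ω x = hitProb (Fintype.card R) T := by
  have : Nonempty R := ⟨x⟩
  simp_rw [hit_eq]
  rw [Finset.expect_sub_distrib, expect_miss, Fintype.expect_const]
  simp [hitProb]

/-- Hits of distinct elements compete for the same draws, so they are negatively correlated. After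
inclusion-exclusion this is `1 - 2 / N ≤ (1 - 1 / N) ^ 2`. -/
theorem expect_hit_mul_hit {R : Type*} [Fintype R] (T : ℕ) {x y : R} (hxy : x ≠ y) :
    𝔼 ω : Fin T → R, hit ω x * hit ω y ≤ hitProb (Fintype.card R) T ^ 2 := by
  have : Nonempty R := ⟨x⟩
  have h : ∀ ω : Fin T → R, hit ω x * hit ω y =
      (1 - (if ∀ j, ω j ∉ ({x} : Finset R) then (1 : ℝ) else 0)
        - (if ∀ j, ω j ∉ ({y} : Finset R) then (1 : ℝ) else 0)) +
        (if ∀ j, ω j ∉ ({x, y} : Finset R) then (1 : ℝ) else 0) := by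
    intro ω
    have h3 : (if ∀ j, ω j ∉ ({x, y} : Finset R) then (1 : ℝ) else 0) =
        (if ∀ j, ω j ∉ ({x} : Finset R) then (1 : ℝ) else 0) *
        (if ∀ j, ω j ∉ ({y} : Finset R) then (1 : ℝ) else 0) := by
      by_cases h1 : ∀ j, ω j ≠ x <;> by_cases h2 : ∀ j, ω j ≠ y <;>
        simp [h1, h2, forall_and]
    rw [hit_eq, hit_eq, h3]
    ring
  simp_rw [h]
  rw [Finset.expect_add_distrib, Finset.expect_sub_distrib, Finset.expect_sub_distrib, expect_miss,
    expect_miss, expect_miss, Fintype.expect_const, Finset.card_pair hxy]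
  have hN : (2 : ℝ) ≤ Fintype.card R := by
    exact_mod_cast Fintype.one_lt_card_iff.2 ⟨x, y, hxy⟩
  have hle : (1 - (2 : ℝ) / Fintype.card R) ^ T ≤
      ((1 - 1 / (Fintype.card R : ℝ)) ^ T) ^ 2 := by
    rw [← pow_mul, mul_comm T 2, pow_mul]
    apply pow_le_pow_left₀
    · rw [sub_nonneg, div_le_one (by linarith)]
      exact hN
    · have : (0 : ℝ) ≤ (1 / (Fintype.card R : ℝ)) ^ 2 := by positivity
      have h2 : (2 : ℝ) / Fintype.card R = 2 * (1 / (Fintype.card R : ℝ)) := by ring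
      rw [h2]
      nlinarith
  simp only [Finset.card_singleton, Nat.cast_one, Nat.cast_ofNat, hitProb]
  nlinarith

theorem hitProb_nonneg (N T : ℕ) : 0 ≤ hitProb N T := by
  unfold hitProb
  rcases Nat.eq_zero_or_pos N with rfl | hN
  · simp
  · have hN' : (1 : ℝ) ≤ N := by exact_mod_cast hN
    have : (1 : ℝ) / N ≤ 1 := by rw [div_le_one (by linarith)]; exact hN'
    have h0 : (0 : ℝ) ≤ 1 / N := by positivity
    linarith [pow_le_one₀ (n := T) (by linarith : (0 : ℝ) ≤ 1 - 1 / N) (by linarith)]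

theorem hitProb_le (N T : ℕ) : hitProb N T ≤ T / N := by
  unfold hitProb
  rcases Nat.eq_zero_or_pos N with rfl | hN
  · simp
  · have hN' : (1 : ℝ) ≤ N := by exact_mod_cast hN
    have h0 : (1 : ℝ) / N ≤ 1 := by rw [div_le_one (by linarith)]; exact hN'
    have := one_add_mul_le_pow (a := -(1 / (N : ℝ))) (by linarith) T
    have h2 : (T : ℝ) * -(1 / (N : ℝ)) = - (T / N) := by ring
    rw [h2] at this
    have h3 : (1 + -(1 / (N : ℝ))) = 1 - 1 / N := by ring
    rw [h3] at this
    linarith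

/-- With `p = T / N ≤ 1`, the miss probability is at most `exp (-p) ≤ 1 / (1 + p) ≤ 1 - p / 2`.
Together with `hitProb_le` this fixes the order of magnitude. -/
theorem le_hitProb {N T : ℕ} (h : (T : ℝ) / N ≤ 1) : (T : ℝ) / N / 2 ≤ hitProb N T := by
  unfold hitProb
  rcases Nat.eq_zero_or_pos N with rfl | hN
  · simp
  · have hN' : (1 : ℝ) ≤ N := by exact_mod_cast hN
    have h0 : (1 : ℝ) / N ≤ 1 := by rw [div_le_one (by linarith)]; exact hN'
    have h1 : (1 - 1 / (N : ℝ)) ^ T ≤ Real.exp (-(T / N)) := by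
      have : Real.exp (-(T / N : ℝ)) = Real.exp (-(1 / (N : ℝ))) ^ T := by
        rw [← Real.exp_nat_mul]; congr 1; ring
      rw [this]
      exact pow_le_pow_left₀ (by linarith) (by linarith [Real.add_one_le_exp (-(1 / (N : ℝ)))]) _
    set p : ℝ := T / N
    have hp : 0 ≤ p := by positivity
    have h2 : Real.exp (-p) ≤ 1 - p / 2 := by
      rw [Real.exp_neg]
      have h3 := Real.add_one_le_exp p
      refine (inv_anti₀ (by linarith) h3).trans ?_
      rw [inv_le_iff_one_le_mul₀ (by linarith)]
      nlinarith
    linarith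

theorem hitProb_le_one (N T : ℕ) : hitProb N T ≤ 1 := by
  unfold hitProb
  rcases Nat.eq_zero_or_pos N with rfl | hN
  · simp
  · have hN' : (1 : ℝ) ≤ N := by exact_mod_cast hN
    have h0 : (1 : ℝ) / N ≤ 1 := by rw [div_le_one (by linarith)]; exact hN'
    linarith [pow_nonneg (by linarith : (0 : ℝ) ≤ 1 - 1 / N) T]

variable {ρ R S : Type*} [Fintype ρ] [DecidableEq ρ] [Fintype R] {T : ρ → ℕ}

/-- The indicator that all targets of `x` with roles in `Q` are hit. -/
noncomputable def hitAll (tgt : ρ → S → R) (Q : Finset ρ) (ω : ∀ i, Fin (T i) → R) (x : S) : ℝ :=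
  ∏ i ∈ Q, hit (ω i) (tgt i x)

theorem hitAll_eq {ρ R S : Type*} {T : ρ → ℕ} (tgt : ρ → S → R) (Q : Finset ρ) (ω : ∀ i, Fin (T i) → R) (x : S) :
    hitAll tgt Q ω x = if ∀ i ∈ Q, tgt i x ∈ Set.range (ω i) then 1 else 0 := by
  unfold hitAll hit
  split_ifs with h
  · exact Finset.prod_eq_one fun i hi => if_pos (h i hi)
  · push Not at h
    obtain ⟨i, hi, hx⟩ := h
    exact Finset.prod_eq_zero hi (if_neg hx)

theorem expect_hitAll (tgt : ρ → S → R) (x : S) :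
    𝔼 ω : ∀ i, Fin (T i) → R, hitAll tgt univ ω x = ∏ i, hitProb (Fintype.card R) (T i) := by
  unfold hitAll
  rw [expect_pi_prod (fun i (a : Fin (T i) → R) => hit a (tgt i x))]
  simp_rw [expect_hit]

/-- Different roles use independent draws, so the expectation factorises. Within a role, a shared
target is paid for once and distinct targets are negatively correlated. -/
theorem expect_hitAll_mul (tgt : ρ → S → R) (Q : Finset ρ) (x y : S) :
    𝔼 ω : ∀ i, Fin (T i) → R, hitAll tgt univ ω x * hitAll tgt Q ω y ≤
      (∏ i, hitProb (Fintype.card R) (T i)) *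
        ∏ i ∈ Q, (if tgt i x = tgt i y then 1 else hitProb (Fintype.card R) (T i)) := by
  unfold hitAll
  have h : ∀ ω : ∀ i, Fin (T i) → R,
      (∏ i, hit (ω i) (tgt i x)) * ∏ i ∈ Q, hit (ω i) (tgt i y) =
      ∏ i, hit (ω i) (tgt i x) * (if i ∈ Q then hit (ω i) (tgt i y) else 1) := by
    intro ω
    rw [Finset.prod_mul_distrib, Finset.prod_ite_mem, Finset.univ_inter]
  simp_rw [h]
  rw [expect_pi_prod (fun i (a : Fin (T i) → R) =>
    hit a (tgt i x) * (if i ∈ Q then hit a (tgt i y) else 1))]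
  have h2 : (∏ i, hitProb (Fintype.card R) (T i)) *
        ∏ i ∈ Q, (if tgt i x = tgt i y then 1 else hitProb (Fintype.card R) (T i)) =
      ∏ i, hitProb (Fintype.card R) (T i) * (if i ∈ Q then
        (if tgt i x = tgt i y then 1 else hitProb (Fintype.card R) (T i)) else 1) := by
    rw [Finset.prod_mul_distrib, Finset.prod_ite_mem, Finset.univ_inter]
  rw [h2]
  refine Finset.prod_le_prod (fun i _ => ?_) (fun i _ => ?_)
  · refine Finset.expect_nonneg fun a _ => mul_nonneg (hit_nonneg _ _) ?_
    split_ifs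
    · exact hit_nonneg _ _
    · norm_num
  · split_ifs with h1 h2
    · simp_rw [← h2, hit_mul_self, expect_hit, mul_one]; exact le_rfl
    · rw [← sq]; exact expect_hit_mul_hit _ h2
    · simp_rw [mul_one, expect_hit]; exact le_rfl

/-- If the number `X` of hit candidates has small variance and the number `Z` of conflicts has small
mean, then `Z < X` with high probability. -/
theorem expect_le_of_second_moment {Ω : Type*} [Fintype Ω] [Nonempty Ω] (X Z : Ω → ℝ)
    (hZ : ∀ ω, 0 ≤ Z ω) {μ ε δ : ℝ} (hμ : 0 < μ) (hX : 𝔼 ω, X ω = μ)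
    (hX2 : 𝔼 ω, X ω ^ 2 ≤ μ ^ 2 * (1 + ε)) (hZm : 𝔼 ω, Z ω ≤ μ * δ) :
    𝔼 ω, (if X ω ≤ Z ω then (1 : ℝ) else 0) ≤ 4 * ε + 2 * δ := by
  -- If `X ≤ Z`, then `Z ≥ μ / 2` or `X < μ / 2`; the two summands are the Markov and Chebyshev
  -- bounds for these events.
  have hpt : ∀ ω, (if X ω ≤ Z ω then (1 : ℝ) else 0) ≤
      4 / μ ^ 2 * (X ω ^ 2 - 2 * μ * X ω + μ ^ 2) + 2 / μ * Z ω := by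
    intro ω
    have e : 4 / μ ^ 2 * (X ω ^ 2 - 2 * μ * X ω + μ ^ 2) = (2 / μ * (X ω - μ)) ^ 2 := by
      field_simp; ring
    have hz : 0 ≤ 2 / μ * Z ω := mul_nonneg (by positivity) (hZ ω)
    rw [e]
    split_ifs with h
    · by_cases h2 : 1 ≤ 2 / μ * Z ω
      · nlinarith [sq_nonneg (2 / μ * (X ω - μ))]
      · push Not at h2
        have h3 : 2 / μ * X ω ≤ 2 / μ * Z ω := by gcongr
        have h4 : 2 / μ * (X ω - μ) = 2 / μ * X ω - 2 := by field_simp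
        rw [h4]
        nlinarith
    · positivity
  refine (Finset.expect_le_expect fun ω _ => hpt ω).trans ?_
  rw [Finset.expect_add_distrib, ← Finset.mul_expect, ← Finset.mul_expect,
    Finset.expect_add_distrib, Finset.expect_sub_distrib, ← Finset.mul_expect, hX,
    Fintype.expect_const]
  have h1 : 4 / μ ^ 2 * (𝔼 ω, X ω ^ 2 - 2 * μ * μ + μ ^ 2) ≤ 4 / μ ^ 2 * (μ ^ 2 * ε) := by
    gcongr; nlinarith
  have h2 : 2 / μ * 𝔼 ω, Z ω ≤ 2 / μ * (μ * δ) := by gcongr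
  have h3 : 4 / μ ^ 2 * (μ ^ 2 * ε) = 4 * ε := by field_simp
  have h4 : 2 / μ * (μ * δ) = 2 * δ := by field_simp
  linarith

end Probability

/-! ### Counting fully hit candidates and their conflicts. -/

section Candidates

open scoped BigOperators Classical
open Finset

variable {m w r l : ℕ}

/-- The coordinates at which two candidates agree. -/
def agree (φ φ' : Fin m → Fin w) : Finset (Fin m) := univ.filter fun i => φ i = φ' i

theorem subset_agree {J : Finset (Fin m)} {φ φ' : Fin m → Fin w} :
    J ⊆ agree φ φ' ↔ ∀ i ∈ J, φ i = φ' i := by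
  simp [agree, Finset.subset_iff]

theorem agree_eq_univ {φ φ' : Fin m → Fin w} : agree φ φ' = univ ↔ φ = φ' := by
  simp [agree, Finset.filter_eq_self, funext_iff]

theorem card_subset_agree (φ : Fin m → Fin w) (J : Finset (Fin m)) :
    (univ.filter fun φ' => J ⊆ agree φ φ').card = w ^ (m - J.card) := by
  have h : (univ.filter fun φ' => J ⊆ agree φ φ') =
      Fintype.piFinset fun i => if i ∈ J then {φ i} else univ := by
    ext φ'
    simp only [subset_agree, mem_filter, mem_univ, true_and, Fintype.mem_piFinset]
    refine forall_congr' fun i => ?_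
    split_ifs with hi
    · simp [hi, eq_comm]
    · simp [hi]
  rw [h, Fintype.card_piFinset]
  have h2 : ∀ i, (if i ∈ J then ({φ i} : Finset (Fin w)) else univ).card =
      if i ∈ J then 1 else w := by
    intro i; split_ifs <;> simp
  simp_rw [h2]
  rw [Finset.prod_ite, Finset.prod_const_one, one_mul, Finset.prod_const]
  congr 1
  have h3 : (univ.filter fun i => i ∉ J) = Jᶜ := by ext; simp
  rw [h3, Finset.card_compl, Fintype.card_fin]

/-- Group the `φ'` by their agreement set `J`; weakening `agree φ φ' = J` to `J ⊆ agree φ φ'` leaves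
`w ^ (m - J.card)` choices. -/
theorem sum_agree_le (φ : Fin m → Fin w) (H : Finset (Fin m) → ℝ) (hH : ∀ J, 0 ≤ H J) :
    ∑ φ', H (agree φ φ') ≤ ∑ J, (w : ℝ) ^ (m - J.card) * H J := by
  rw [← Finset.sum_fiberwise (s := univ) (g := fun φ' => agree φ φ')]
  refine Finset.sum_le_sum fun J _ => ?_
  rw [Finset.sum_congr rfl (g := fun _ => H J) (fun x hx => by rw [(mem_filter.1 hx).2]),
    Finset.sum_const, nsmul_eq_mul]
  refine mul_le_mul_of_nonneg_right ?_ (hH J)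
  rw [← Nat.cast_pow, ← card_subset_agree φ J]
  exact_mod_cast Finset.card_le_card fun x hx => by
    simp only [mem_filter, mem_univ, true_and] at hx ⊢
    exact hx.ge

theorem card_powersetCard_subset (J : Finset (Fin m)) :
    (univ.filter fun f : Set.powersetCard (Fin m) r => f.1 ⊆ J).card = J.card.choose r := by
  rw [← Finset.card_powersetCard]
  refine Finset.card_bij (fun f _ => f.1) ?_ ?_ ?_
  · intro f hf
    exact Finset.mem_powersetCard.2 ⟨(mem_filter.1 hf).2, f.2⟩
  · intro f _ g _ h
    exact Subtype.ext h
  · intro f hf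
    rw [Finset.mem_powersetCard] at hf
    exact ⟨⟨f, hf.2⟩, by simpa using hf.1, rfl⟩

theorem card_powersetCard_fin (n r : ℕ) :
    Fintype.card (Set.powersetCard (Fin n) r) = n.choose r := by
  rw [Fintype.card_eq_nat_card, Set.powersetCard.card, Nat.card_fin]

theorem prod_powersetCard (J : Finset (Fin m)) (q : ℝ) :
    ∏ f : Set.powersetCard (Fin m) r, (if f.1 ⊆ J then 1 else q) =
      q ^ (m.choose r - J.card.choose r) := by
  rw [Finset.prod_ite, Finset.prod_const_one, one_mul, Finset.prod_const]
  congr 1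
  have := Finset.card_filter_add_card_filter_not (s := univ)
    (fun f : Set.powersetCard (Fin m) r => f.1 ⊆ J)
  rw [card_powersetCard_subset, Finset.card_univ, card_powersetCard_fin] at this
  omega

/-- The roles played by random sets: one for every `r`-subset of the candidate, and then one for
each of the `l` surplus edges. -/
abbrev Role (m r l : ℕ) : Type := Set.powersetCard (Fin m) r ⊕ Fin l

/-- The coordinates of a candidate which are relevant to a role. -/
def support (U : Fin l → Set.powersetCard (Fin m) r) : Role m r l → Finset (Fin m) :=
  Sum.elim (fun f => f.1) (fun i => (U i).1)

/-- The number of rounds which are devoted to a role. -/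
abbrev rounds (m r l T₁ T₂ : ℕ) : Role m r l → ℕ := Sum.elim (fun _ => T₁) (fun _ => T₂)

/-- Some candidate has all its targets hit, and shares none of the targets of its surplus edges
with another candidate whose first `C(m, r)` targets are hit. -/
def Good {R : Type*} {T : Role m r l → ℕ} (tgt : Role m r l → (Fin m → Fin w) → R)
    (ω : ∀ i, Fin (T i) → R) : Prop :=
  ∃ φ, (∀ ρ, tgt ρ φ ∈ Set.range (ω ρ)) ∧
    ∀ φ', (∀ f, tgt (.inl f) φ' ∈ Set.range (ω (.inl f))) →
      ∀ i, tgt (.inr i) φ' = tgt (.inr i) φ → φ' = φ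

/-- The number of candidates with all targets hit. -/
noncomputable def hitCount {R : Type*} {T : Role m r l → ℕ}
    (tgt : Role m r l → (Fin m → Fin w) → R) (ω : ∀ i, Fin (T i) → R) : ℝ :=
  ∑ φ, hitAll tgt univ ω φ

/-- The roles of the first kind. -/
noncomputable def cliqueRoles (m r l : ℕ) : Finset (Role m r l) := univ.filter fun ρ => ρ.isLeft

/-- The number of conflicts. -/
noncomputable def conflictCount {R : Type*} {T : Role m r l → ℕ}
    (tgt : Role m r l → (Fin m → Fin w) → R) (ω : ∀ i, Fin (T i) → R) : ℝ :=
  ∑ φ, ∑ φ', ∑ i, if φ' ≠ φ ∧ tgt (.inr i) φ' = tgt (.inr i) φ then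
    hitAll tgt univ ω φ * hitAll tgt (cliqueRoles m r l) ω φ' else 0

/-- When `Good` fails, each fully hit candidate has a rival, hence contributes at least one
conflict. -/
theorem hitCount_le_conflictCount {R : Type*} {T : Role m r l → ℕ}
    {tgt : Role m r l → (Fin m → Fin w) → R} {ω : ∀ i, Fin (T i) → R} (h : ¬ Good tgt ω) :
    hitCount tgt ω ≤ conflictCount tgt ω := by
  have h0 : ∀ Q φ, 0 ≤ hitAll tgt Q ω φ := fun Q φ => Finset.prod_nonneg fun _ _ => hit_nonneg _ _
  have hterm : ∀ φ φ' i, 0 ≤ (if φ' ≠ φ ∧ tgt (.inr i) φ' = tgt (.inr i) φ then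
      hitAll tgt univ ω φ * hitAll tgt (cliqueRoles m r l) ω φ' else 0) := by
    intro φ φ' i
    split_ifs
    · exact mul_nonneg (h0 _ _) (h0 _ _)
    · exact le_rfl
  refine Finset.sum_le_sum fun φ _ => ?_
  by_cases hφ : ∀ ρ ∈ (univ : Finset (Role m r l)), tgt ρ φ ∈ Set.range (ω ρ)
  · unfold Good at h
    push Not at h
    obtain ⟨φ', h1, i, h2, h3⟩ := h φ fun ρ => hφ ρ (mem_univ _)
    refine le_trans ?_ (Finset.single_le_sum (fun φ' _ => Finset.sum_nonneg fun i _ => hterm φ φ' i)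
      (mem_univ φ'))
    refine le_trans ?_ (Finset.single_le_sum (fun i _ => hterm φ φ' i) (mem_univ i))
    rw [if_pos ⟨h3, h2⟩, hitAll_eq, hitAll_eq, if_pos hφ, if_pos, one_mul]
    rintro (f | i) hρ
    · exact h1 f
    · simp [cliqueRoles] at hρ
  · refine le_trans (b := 0) (le_of_eq (by rw [hitAll_eq, if_neg hφ])) ?_
    exact Finset.sum_nonneg fun φ' _ => Finset.sum_nonneg fun i _ => hterm φ φ' i

/-- The relative variance bound for the number of candidates with all targets hit. -/
noncomputable def varianceBound (m r l : ℕ) (w q₁ q₂ : ℝ) : ℝ :=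
  ∑ J : Finset (Fin m), if r ≤ J.card then
    (w ^ J.card * q₁ ^ J.card.choose r * q₂ ^ l)⁻¹ else 0

/-- The bound for the mean number of conflicts of a candidate. -/
noncomputable def conflictBound (m r l : ℕ) (w q₁ : ℝ) : ℝ :=
  l * ∑ J : Finset (Fin m), if r ≤ J.card ∧ J.card < m then
    w ^ (m - J.card) * q₁ ^ (m.choose r - J.card.choose r) else 0

variable {R : Type*} [Fintype R] {T₁ T₂ : ℕ} {U : Fin l → Set.powersetCard (Fin m) r}
  {tgt : Role m r l → (Fin m → Fin w) → R}

theorem prod_hitProb (N : ℕ) : ∏ ρ : Role m r l, hitProb N (rounds m r l T₁ T₂ ρ) =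
    hitProb N T₁ ^ m.choose r * hitProb N T₂ ^ l := by
  rw [Fintype.prod_sum_type]
  simp only [Sum.elim_inl, Sum.elim_inr, prod_const, card_univ, card_powersetCard_fin,
    Fintype.card_fin]

theorem expect_hitCount :
    𝔼 ω : ∀ ρ, Fin (rounds m r l T₁ T₂ ρ) → R, hitCount tgt ω =
      (w : ℝ) ^ m * (hitProb (Fintype.card R) T₁ ^ m.choose r *
        hitProb (Fintype.card R) T₂ ^ l) := by
  unfold hitCount
  rw [Finset.expect_sum_comm]
  simp_rw [expect_hitAll, prod_hitProb]
  simp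

/-- Candidates agreeing in fewer than `r` coordinates share no target and contribute at most the
squared mean. Agreement exactly on a larger `J` saves `C(J.card, r)` factors `q₁`, and at most all
`l` factors `q₂`; the bound concedes all of the latter. -/
theorem expect_hitCount_sq (htgt : ∀ ρ φ φ', tgt ρ φ = tgt ρ φ' ↔ support U ρ ⊆ agree φ φ')
    (hw : 0 < w) (h₁ : 0 < hitProb (Fintype.card R) T₁) (h₂ : 0 < hitProb (Fintype.card R) T₂) :
    𝔼 ω : ∀ ρ, Fin (rounds m r l T₁ T₂ ρ) → R, hitCount tgt ω ^ 2 ≤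
      ((w : ℝ) ^ m * (hitProb (Fintype.card R) T₁ ^ m.choose r *
        hitProb (Fintype.card R) T₂ ^ l)) ^ 2 *
      (1 + varianceBound m r l w (hitProb (Fintype.card R) T₁) (hitProb (Fintype.card R) T₂)) := by
  have h0 : ∀ T, 0 ≤ hitProb (Fintype.card R) T := hitProb_nonneg _
  have hone : ∀ T, hitProb (Fintype.card R) T ≤ 1 := hitProb_le_one _
  set p : ℕ → ℝ := hitProb (Fintype.card R)
  set μ := p T₁ ^ m.choose r * p T₂ ^ l with hμ
  have hμ0 : 0 < μ := by positivity
  have hJ : ∀ J : Finset (Fin m),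
      ∏ ρ, (if support U ρ ⊆ J then 1 else p (rounds m r l T₁ T₂ ρ)) ≤
        μ + if r ≤ J.card then μ * (p T₁ ^ J.card.choose r * p T₂ ^ l)⁻¹ else 0 := by
    intro J
    split_ifs with hr
    · refine le_trans ?_ (le_add_of_nonneg_left hμ0.le)
      rw [Fintype.prod_sum_type]
      have e1 : (∏ f, if support U (.inl f) ⊆ J then 1 else p (rounds m r l T₁ T₂ (.inl f))) =
          p T₁ ^ (m.choose r - J.card.choose r) := prod_powersetCard (r := r) J (p T₁)
      rw [e1]
      have hc : J.card.choose r ≤ m.choose r :=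
        Nat.choose_le_choose r (by simpa using Finset.card_le_univ J)
      have e : μ * (p T₁ ^ J.card.choose r * p T₂ ^ l)⁻¹ =
          p T₁ ^ (m.choose r - J.card.choose r) := by
        rw [hμ, ← Nat.sub_add_cancel hc, pow_add]
        simp only [Nat.add_sub_cancel]
        field_simp
      rw [e]
      refine mul_le_of_le_one_right (by positivity) (Finset.prod_le_one ?_ ?_)
      · intro i _; split_ifs
        · norm_num
        · exact h0 _
      · intro i _; split_ifs
        · norm_num
        · exact hone _
    · rw [add_zero, hμ, ← prod_hitProb]
      refine le_of_eq (Finset.prod_congr rfl fun ρ _ => if_neg fun hsub => hr ?_)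
      have hcard : (support U ρ).card = r := by
        rcases ρ with f | i
        · exact f.2
        · exact (U i).2
      exact hcard ▸ Finset.card_le_card hsub
  have hpair : ∀ φ φ' : Fin m → Fin w,
      𝔼 ω : ∀ ρ, Fin (rounds m r l T₁ T₂ ρ) → R, hitAll tgt univ ω φ * hitAll tgt univ ω φ' ≤
      μ * (μ + if r ≤ (agree φ φ').card then
        μ * (p T₁ ^ (agree φ φ').card.choose r * p T₂ ^ l)⁻¹ else 0) := by
    intro φ φ'
    refine (expect_hitAll_mul tgt univ φ φ').trans ?_
    rw [prod_hitProb]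
    simp_rw [htgt]
    exact mul_le_mul_of_nonneg_left (hJ _) hμ0.le
  unfold hitCount
  simp_rw [sq, Finset.sum_mul_sum]
  rw [Finset.expect_sum_comm]
  simp_rw [Finset.expect_sum_comm]
  have hφ : ∀ φ : Fin m → Fin w, ∑ φ' : Fin m → Fin w,
      𝔼 ω : ∀ ρ, Fin (rounds m r l T₁ T₂ ρ) → R, hitAll tgt univ ω φ * hitAll tgt univ ω φ' ≤
      (w : ℝ) ^ m * μ ^ 2 * (1 + varianceBound m r l w (p T₁) (p T₂)) := by
    intro φ
    refine (Finset.sum_le_sum fun φ' _ => hpair φ φ').trans ?_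
    rw [← Finset.mul_sum, Finset.sum_add_distrib]
    have h := sum_agree_le φ (fun J => if r ≤ J.card then
      μ * (p T₁ ^ J.card.choose r * p T₂ ^ l)⁻¹ else 0) (fun J => by split_ifs <;> positivity)
    have e : ∑ J : Finset (Fin m), (w : ℝ) ^ (m - J.card) * (if r ≤ J.card then
        μ * (p T₁ ^ J.card.choose r * p T₂ ^ l)⁻¹ else 0) =
        (w : ℝ) ^ m * μ * varianceBound m r l w (p T₁) (p T₂) := by
      unfold varianceBound
      rw [Finset.mul_sum]
      refine Finset.sum_congr rfl fun J _ => ?_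
      split_ifs
      · have hc : J.card ≤ m := by simpa using Finset.card_le_univ J
        have : (w : ℝ) ^ m = (w : ℝ) ^ (m - J.card) * (w : ℝ) ^ J.card := by
          rw [← pow_add, Nat.sub_add_cancel hc]
        rw [this]
        field_simp
      · simp
    rw [e] at h
    have e2 : ∑ _φ' : Fin m → Fin w, μ = (w : ℝ) ^ m * μ := by simp
    rw [e2]
    calc _ ≤ μ * ((w : ℝ) ^ m * μ + (w : ℝ) ^ m * μ * varianceBound m r l w (p T₁) (p T₂)) := by
          gcongr
      _ = _ := by ring
  refine (Finset.sum_le_sum fun φ _ => hφ φ).trans (le_of_eq ?_)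
  rw [Finset.sum_const, Finset.card_univ, Fintype.card_fun, Fintype.card_fin, Fintype.card_fin,
    nsmul_eq_mul]
  push_cast
  ring

/-- A common surplus target forces agreement in at least `r` coordinates, but not in all. Given `φ`,
the rival pays `q₁` for each unshared target of the first kind and nothing for surplus targets,
since the player looks only at the former. -/
theorem expect_conflictCount (htgt : ∀ ρ φ φ', tgt ρ φ = tgt ρ φ' ↔ support U ρ ⊆ agree φ φ') :
    𝔼 ω : ∀ ρ, Fin (rounds m r l T₁ T₂ ρ) → R, conflictCount tgt ω ≤
      ((w : ℝ) ^ m * (hitProb (Fintype.card R) T₁ ^ m.choose r *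
        hitProb (Fintype.card R) T₂ ^ l)) *
      conflictBound m r l w (hitProb (Fintype.card R) T₁) := by
  have h0 : ∀ T, 0 ≤ hitProb (Fintype.card R) T := hitProb_nonneg _
  set p : ℕ → ℝ := hitProb (Fintype.card R)
  set μ := p T₁ ^ m.choose r * p T₂ ^ l with hμ
  have hμ0 : 0 ≤ μ := mul_nonneg (pow_nonneg (h0 _) _) (pow_nonneg (h0 _) _)
  have hpair : ∀ φ φ' : Fin m → Fin w, ∀ i,
      𝔼 ω : ∀ ρ, Fin (rounds m r l T₁ T₂ ρ) → R,
        (if φ' ≠ φ ∧ tgt (.inr i) φ' = tgt (.inr i) φ then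
          hitAll tgt univ ω φ * hitAll tgt (cliqueRoles m r l) ω φ' else 0) ≤
      μ * (if r ≤ (agree φ φ').card ∧ (agree φ φ').card < m then
        p T₁ ^ (m.choose r - (agree φ φ').card.choose r) else 0) := by
    intro φ φ' i
    by_cases h : φ' ≠ φ ∧ tgt (.inr i) φ' = tgt (.inr i) φ
    · simp only [if_pos h]
      rw [if_pos]
      · refine (expect_hitAll_mul tgt _ φ φ').trans (le_of_eq ?_)
        rw [prod_hitProb]
        congr 1
        unfold cliqueRoles
        rw [Finset.prod_filter, Fintype.prod_sum_type]
        simp_rw [htgt]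
        simp only [Sum.isLeft_inl, Sum.isLeft_inr, if_true, support, Sum.elim_inl, rounds,
          Bool.false_eq_true, if_false, Finset.prod_const_one, mul_one]
        exact prod_powersetCard _ _
      · constructor
        · have := Finset.card_le_card ((htgt _ _ _).1 h.2.symm)
          rwa [show (support U (.inr i)).card = r from (U i).2] at this
        · have hle : (agree φ φ').card ≤ m := by simpa using Finset.card_le_univ (agree φ φ')
          refine lt_of_le_of_ne hle fun hm => h.1 ?_
          refine (agree_eq_univ.1 ((Finset.card_eq_iff_eq_univ _).1 ?_)).symm
          simpa using hm
    · simp only [if_neg h, Finset.expect_const_zero]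
      refine mul_nonneg hμ0 ?_
      split_ifs
      · exact pow_nonneg (h0 _) _
      · exact le_rfl
  unfold conflictCount
  rw [Finset.expect_sum_comm]
  simp_rw [Finset.expect_sum_comm]
  have hφ : ∀ φ : Fin m → Fin w, (∑ φ' : Fin m → Fin w, ∑ i : Fin l,
      𝔼 ω : ∀ ρ, Fin (rounds m r l T₁ T₂ ρ) → R,
        (if φ' ≠ φ ∧ tgt (.inr i) φ' = tgt (.inr i) φ then
          hitAll tgt univ ω φ * hitAll tgt (cliqueRoles m r l) ω φ' else 0)) ≤
      μ * conflictBound m r l w (p T₁) := by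
    intro φ
    refine (Finset.sum_le_sum fun φ' _ => Finset.sum_le_sum fun i _ => hpair φ φ' i).trans ?_
    simp only [Finset.sum_const, Finset.card_univ, Fintype.card_fin, nsmul_eq_mul]
    rw [← Finset.mul_sum, ← Finset.mul_sum]
    have h := sum_agree_le φ (fun J => if r ≤ J.card ∧ J.card < m then
        p T₁ ^ (m.choose r - J.card.choose r) else 0)
      (fun J => by
        split_ifs
        · exact pow_nonneg (h0 _) _
        · exact le_rfl)
    unfold conflictBound
    simp only [mul_ite, mul_zero] at h
    exact (mul_le_mul_of_nonneg_left (mul_le_mul_of_nonneg_left h hμ0) (Nat.cast_nonneg l)).trans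
      (le_of_eq (by ring))
  refine (Finset.sum_le_sum fun φ _ => hφ φ).trans (le_of_eq ?_)
  rw [Finset.sum_const, Finset.card_univ, Fintype.card_fun, Fintype.card_fin, Fintype.card_fin,
    nsmul_eq_mul]
  push_cast
  ring

theorem expect_not_good [Nonempty R]
    (htgt : ∀ ρ φ φ', tgt ρ φ = tgt ρ φ' ↔ support U ρ ⊆ agree φ φ')
    (hw : 0 < w) (h₁ : 0 < hitProb (Fintype.card R) T₁) (h₂ : 0 < hitProb (Fintype.card R) T₂) :
    𝔼 ω : ∀ ρ, Fin (rounds m r l T₁ T₂ ρ) → R, (if Good tgt ω then (0 : ℝ) else 1) ≤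
      4 * varianceBound m r l w (hitProb (Fintype.card R) T₁) (hitProb (Fintype.card R) T₂) +
      2 * conflictBound m r l w (hitProb (Fintype.card R) T₁) := by
  refine le_trans (Finset.expect_le_expect fun ω _ => ?_)
    (expect_le_of_second_moment (hitCount tgt) (conflictCount tgt) (fun ω => ?_) (by positivity)
      expect_hitCount (expect_hitCount_sq htgt hw h₁ h₂) (expect_conflictCount htgt))
  · by_cases h : Good tgt ω
    · rw [if_pos h]; split_ifs <;> norm_num
    · rw [if_neg h, if_pos (hitCount_le_conflictCount h)]
  · refine Finset.sum_nonneg fun φ _ => Finset.sum_nonneg fun φ' _ => Finset.sum_nonneg fun i _ => ?_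
    split_ifs
    · exact mul_nonneg (Finset.prod_nonneg fun _ _ => hit_nonneg _ _)
        (Finset.prod_nonneg fun _ _ => hit_nonneg _ _)
    · exact le_rfl

end Candidates

/-! ### Deterministic strategies as functions of a uniform sequence of draws. -/

section Law

open scoped BigOperators Classical

/-- The history when `ω` lists the random sets and the player answers according to `v`. -/
def history {r s n : ℕ}
    (v : List (Round r s n) → Set.powersetCard (Fin n) r → Set.powersetCard (Fin n) (s - r)) :
    (t : ℕ) → (Fin t → Set.powersetCard (Fin n) r) → List (Round r s n)
  | 0, _ => []
  | t + 1, ω => (ω (Fin.last t), v (history v t (Fin.init ω)) (ω (Fin.last t))) ::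
      history v t (Fin.init ω)

theorem uniformOfFintype_snoc {R : Type*} [Fintype R] [Nonempty R] (t : ℕ) :
    PMF.uniformOfFintype (Fin (t + 1) → R) =
      (PMF.uniformOfFintype (Fin t → R)).bind fun ω =>
        (PMF.uniformOfFintype R).bind fun U => PMF.pure (Fin.snoc ω U) := by
  ext x
  have h : ∀ (ω : Fin t → R) (U : R), (x = (Fin.snoc ω U : Fin (t + 1) → R)) ↔
      (Fin.init x = ω ∧ x (Fin.last t) = U) := by
    intro ω U
    constructor
    · rintro rfl
      simp
    · rintro ⟨rfl, rfl⟩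
      simp
  simp only [PMF.bind_apply, PMF.uniformOfFintype_apply, PMF.pure_apply, tsum_fintype, h,
    ite_and]
  rw [Finset.sum_eq_single (Fin.init x), Finset.sum_eq_single (x (Fin.last t))]
  · simp only [if_true, mul_one, Fintype.card_fun, Fintype.card_fin]
    rw [pow_succ, Nat.cast_mul, ENNReal.mul_inv] <;> simp
  · intro U _ hU
    simp [hU.symm]
  · simp
  · intro ω _ hω
    simp [hω.symm]
  · simp

/-- Against a deterministic player the draws are the only randomness, so probabilities become
averages over a finite product space. -/
theorem historyLaw_pure {r s n : ℕ} (h : r ≤ n) [Nonempty (Set.powersetCard (Fin n) r)]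
    (v : List (Round r s n) → Set.powersetCard (Fin n) r → Set.powersetCard (Fin n) (s - r))
    (t : ℕ) :
    historyLaw h (fun past U => PMF.pure (v past U)) t =
      (PMF.uniformOfFintype (Fin t → Set.powersetCard (Fin n) r)).map (history v t) := by
  induction t with
  | zero =>
    have : (history v 0 : (Fin 0 → Set.powersetCard (Fin n) r) → _) = Function.const _ [] := rfl
    rw [this, PMF.map_const]
    rfl
  | succ t ih =>
    rw [historyLaw, ih, uniformOfFintype_snoc, PMF.bind_map, PMF.map_bind]
    congr 1
    funext ω
    rw [PMF.map_bind]
    simp only [Function.comp_apply, PMF.pure_map, history, Fin.init_snoc, Fin.snoc_last]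
    rfl

theorem history_fst {r s n : ℕ}
    (v : List (Round r s n) → Set.powersetCard (Fin n) r → Set.powersetCard (Fin n) (s - r))
    (t : ℕ) (ω : Fin t → Set.powersetCard (Fin n) r) :
    ((history v t ω).map Prod.fst).reverse = List.ofFn ω := by
  induction t with
  | zero => simp [history]
  | succ t ih =>
    rw [history, List.map_cons, List.reverse_cons, ih, List.ofFn_succ', List.concat_eq_append]
    rfl

theorem mem_history {r s n : ℕ}
    (v : List (Round r s n) → Set.powersetCard (Fin n) r → Set.powersetCard (Fin n) (s - r))
    (t : ℕ) (ω : Fin t → Set.powersetCard (Fin n) r) (i : Fin t) :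
    (ω i, v (history v i fun j => ω (j.castLE i.2.le)) (ω i)) ∈ history v t ω := by
  induction t with
  | zero => exact i.elim0
  | succ t ih =>
    rw [history]
    refine Fin.lastCases ?_ (fun i => ?_) i
    · exact List.mem_cons_self
    · exact List.mem_cons_of_mem _ (ih (Fin.init ω) i)

theorem strategyTime_pure_le {r s n : ℕ} (P : HProperty) (h : r ≤ n)
    (v : List (Round r s n) → Set.powersetCard (Fin n) r → Set.powersetCard (Fin n) (s - r))
    (t : ℕ) (q : ℝ) (G : (Fin t → Set.powersetCard (Fin n) r) → Prop)
    (hG : ∀ ω, G ω → P n (built (history v t ω)))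
    (hq : 𝔼 ω, (if G ω then (0 : ℝ) else 1) ≤ 1 - q) :
    strategyTime P h (fun past U => PMF.pure (v past U)) q ≤ t := by
  have := powersetCard_nonempty h
  refine iInf₂_le t ?_
  rw [processLaw, historyLaw_pure, PMF.map_comp, PMF.toOuterMeasure_map_apply]
  have hsub : {ω | G ω} ⊆ built ∘ history v t ⁻¹' {H | P n H} := fun ω hω => hG ω hω
  refine le_trans ?_ (MeasureTheory.measure_mono hsub)
  rw [PMF.toOuterMeasure_uniformOfFintype_apply]
  set K := Fintype.card (Fin t → Set.powersetCard (Fin n) r) with hK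
  have hK0 : 0 < (K : ℝ) := by exact_mod_cast Fintype.card_pos
  have h1 : 𝔼 ω, (if G ω then (0 : ℝ) else 1) = 1 - (Fintype.card {ω | G ω} : ℝ) / K := by
    have e : ∀ ω, (if G ω then (0 : ℝ) else 1) = 1 - if G ω then 1 else 0 := by
      intro ω; split_ifs <;> norm_num
    simp_rw [e]
    rw [Finset.expect_sub_distrib, Fintype.expect_const, Fintype.expect_eq_sum_div_card,
      Finset.sum_boole, Fintype.card_subtype]
    rfl
  rw [h1] at hq
  have h2 : ENNReal.ofReal q ≤ ENNReal.ofReal ((Fintype.card {ω | G ω} : ℝ) / K) :=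
    ENNReal.ofReal_le_ofReal (by linarith)
  rwa [ENNReal.ofReal_div_of_pos hK0, ENNReal.ofReal_natCast, ENNReal.ofReal_natCast] at h2

end Law

/-! ### The two-phase player and its schedule of rounds. -/

section Player

open scoped BigOperators Classical

variable {r s n m w l T : ℕ} {A : Role m r l → ℕ}

/-- A strategy for collecting the surplus edges of a candidate: rounds devoted to a role of the
first kind are answered by `base`, and in a round devoted to a surplus edge the player helps a
candidate whose targets of the first kind have been hit before. -/
noncomputable def player (e : Fin T ≃ Σ ρ, Fin (A ρ))
    (tgt : Role m r l → (Fin m → Fin w) → Set.powersetCard (Fin n) r)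
    (ans : Fin l → (Fin m → Fin w) → Set.powersetCard (Fin n) (s - r))
    (base : Set.powersetCard (Fin n) (s - r))
    (past : List (Round r s n)) (U : Set.powersetCard (Fin n) r) :
    Set.powersetCard (Fin n) (s - r) :=
  if ht : past.length < T then
    (e ⟨past.length, ht⟩).1.elim (fun _ => base) fun i =>
      if h : ∃ φ, (∀ f, ∃ j, (past.map Prod.fst).reverse[(e.symm ⟨.inl f, j⟩ : ℕ)]? =
        some (tgt (.inl f) φ)) ∧ tgt (.inr i) φ = U then ans i h.choose else base
  else base

theorem length_history
    (v : List (Round r s n) → Set.powersetCard (Fin n) r → Set.powersetCard (Fin n) (s - r))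
    (t : ℕ) (ω : Fin t → Set.powersetCard (Fin n) r) : (history v t ω).length = t := by
  have := congrArg List.length (history_fst v t ω)
  simpa using this

/-- By `he` all rounds of the first kind are already visible when a surplus round comes. The
candidate found by choice then satisfies the hypotheses of the uniqueness clause of `Good`, so it is
`φ` itself. -/
theorem mem_history_player (e : Fin T ≃ Σ ρ, Fin (A ρ))
    (he : ∀ f j i j', e.symm ⟨.inl f, j⟩ < e.symm ⟨.inr i, j'⟩)
    (tgt : Role m r l → (Fin m → Fin w) → Set.powersetCard (Fin n) r)
    (ans : Fin l → (Fin m → Fin w) → Set.powersetCard (Fin n) (s - r))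
    (base : Set.powersetCard (Fin n) (s - r)) (ω : Fin T → Set.powersetCard (Fin n) r)
    (h : Good tgt fun ρ j => ω (e.symm ⟨ρ, j⟩)) :
    ∃ φ, (∀ f, (tgt (.inl f) φ, base) ∈ history (player e tgt ans base) T ω) ∧
      ∀ i, (tgt (.inr i) φ, ans i φ) ∈ history (player e tgt ans base) T ω := by
  obtain ⟨φ, hφ, huniq⟩ := h
  refine ⟨φ, fun f => ?_, fun i => ?_⟩
  · obtain ⟨j, hj⟩ := hφ (.inl f)
    have hmem := mem_history (player e tgt ans base) T ω (e.symm ⟨.inl f, j⟩)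
    dsimp only at hj
    rw [hj] at hmem
    convert hmem using 2
    simp [player, length_history]
  · obtain ⟨j, hj⟩ := hφ (.inr i)
    have hmem := mem_history (player e tgt ans base) T ω (e.symm ⟨.inr i, j⟩)
    dsimp only at hj
    rw [hj] at hmem
    convert hmem using 2
    -- The truncated history still contains every draw of the first phase, so a lookup in it returns
    -- the actual draw.
    have hget : ∀ (f : Set.powersetCard (Fin m) r) (j' : Fin (A (.inl f))) x,
        (List.ofFn fun k : Fin (e.symm ⟨.inr i, j⟩ : ℕ) =>
          ω (k.castLE (e.symm ⟨.inr i, j⟩).2.le))[(e.symm ⟨.inl f, j'⟩ : ℕ)]? = some x ↔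
        ω (e.symm ⟨.inl f, j'⟩) = x := by
      intro f j' x
      rw [List.getElem?_ofFn, dif_pos (Fin.lt_def.1 (he f j' i j))]
      simp
    simp only [player, length_history, history_fst, hget]
    rw [dif_pos (e.symm ⟨.inr i, j⟩).2]
    simp only [Fin.eta, Equiv.apply_symm_apply, Sum.elim_inr]
    have hex : ∃ φ', (∀ f, ∃ j', ω (e.symm ⟨.inl f, j'⟩) = tgt (.inl f) φ') ∧
        tgt (.inr i) φ' = tgt (.inr i) φ := ⟨φ, fun f => hφ (.inl f), rfl⟩
    rw [dif_pos hex]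
    rw [huniq hex.choose hex.choose_spec.1 i hex.choose_spec.2]

theorem exists_schedule (m r l T₁ T₂ : ℕ) :
    ∃ e : Fin (m.choose r * T₁ + l * T₂) ≃ Σ ρ : Role m r l, Fin (rounds m r l T₁ T₂ ρ),
      ∀ f j i j', e.symm ⟨.inl f, j⟩ < e.symm ⟨.inr i, j'⟩ := by
  let e₁ : Fin (m.choose r * T₁) ≃ Σ f : Set.powersetCard (Fin m) r,
      Fin (rounds m r l T₁ T₂ (.inl f)) :=
    (Fintype.equivFinOfCardEq (by
      rw [Fintype.card_sigma]
      exact (Finset.sum_const_nat fun _ _ => Fintype.card_fin T₁).trans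
        (by rw [Finset.card_univ, card_powersetCard_fin]))).symm
  let e₂ : Fin (l * T₂) ≃ Σ i : Fin l, Fin (rounds m r l T₁ T₂ (.inr i)) :=
    (Fintype.equivFinOfCardEq (by
      rw [Fintype.card_sigma]
      exact (Finset.sum_const_nat fun _ _ => Fintype.card_fin T₂).trans
        (by rw [Finset.card_univ, Fintype.card_fin]))).symm
  refine ⟨finSumFinEquiv.symm.trans ((Equiv.sumCongr e₁ e₂).trans
    (Equiv.sumSigmaDistrib fun ρ => Fin (rounds m r l T₁ T₂ ρ)).symm), fun f j i j' => ?_⟩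
  simp only [Equiv.symm_trans_apply, Equiv.symm_symm, Equiv.sumSigmaDistrib_apply,
    Equiv.sumCongr_symm, Equiv.sumCongr_apply, Sum.map_inl, Sum.map_inr, finSumFinEquiv_apply_left,
    finSumFinEquiv_apply_right]
  rw [Fin.lt_def]
  simp only [Fin.val_castAdd, Fin.val_natAdd]
  omega

theorem expect_schedule {R : Type*} [Fintype R] (e : Fin T ≃ Σ ρ, Fin (A ρ))
    (F : (∀ ρ, Fin (A ρ) → R) → ℝ) :
    𝔼 ω : Fin T → R, F (fun ρ j => ω (e.symm ⟨ρ, j⟩)) = 𝔼 ω, F ω := by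
  refine Fintype.expect_equiv ((e.arrowCongr (Equiv.refl R)).trans
    (Equiv.piCurry fun _ _ => R)) _ _ fun ω => ?_
  rfl

end Player

/-! ### Embedding candidates in `[n]` and recognising a copy of `G`. -/

section Placement

open scoped BigOperators Classical

variable {α : Type*} {m w d n r s l : ℕ}

/-- The vertices of a candidate, together with `d` common vertices. -/
def place (ψ : (Fin m × Fin w) ⊕ Fin d ↪ Fin n) (φ : Fin m → Fin w) : Fin m ⊕ Fin d ↪ Fin n where
  toFun := Sum.elim (fun i => ψ (.inl (i, φ i))) fun j => ψ (.inr j)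
  inj' := by
    rintro (i | j) (i' | j') h <;> simp_all

theorem place_inl (ψ : (Fin m × Fin w) ⊕ Fin d ↪ Fin n) (φ : Fin m → Fin w) (i : Fin m) :
    place ψ φ (.inl i) = ψ (.inl (i, φ i)) := rfl

theorem place_inr (ψ : (Fin m × Fin w) ⊕ Fin d ↪ Fin n) (φ : Fin m → Fin w) (j : Fin d) :
    place ψ φ (.inr j) = ψ (.inr j) := rfl

/-- The targets of a candidate. -/
def target (ψ : (Fin m × Fin w) ⊕ Fin d ↪ Fin n) (U : Fin l → Set.powersetCard (Fin m) r)
    (ρ : Role m r l) (φ : Fin m → Fin w) : Set.powersetCard (Fin n) r :=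
  Set.powersetCard.map r (Function.Embedding.inl.trans (place ψ φ)) (Sum.elim id U ρ)

theorem mem_target {ψ : (Fin m × Fin w) ⊕ Fin d ↪ Fin n} {U : Fin l → Set.powersetCard (Fin m) r}
    {ρ : Role m r l} {φ : Fin m → Fin w} {x : Fin n} :
    x ∈ (target ψ U ρ φ).1 ↔ ∃ i ∈ support U ρ, place ψ φ (.inl i) = x := by
  rcases ρ with f | i <;> simp [target, support]

/-- The blocks are disjoint, so a vertex reveals its coordinate as well as the choice made there. -/
theorem target_eq_iff (ψ : (Fin m × Fin w) ⊕ Fin d ↪ Fin n)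
    (U : Fin l → Set.powersetCard (Fin m) r) (ρ : Role m r l) (φ φ' : Fin m → Fin w) :
    target ψ U ρ φ = target ψ U ρ φ' ↔ support U ρ ⊆ agree φ φ' := by
  rw [subset_agree]
  constructor
  · intro h i hi
    have h1 : place ψ φ (.inl i) ∈ (target ψ U ρ φ').1 := h ▸ mem_target.2 ⟨i, hi, rfl⟩
    obtain ⟨i', -, h2⟩ := mem_target.1 h1
    have h3 := ψ.injective h2
    simp only [Sum.inl.injEq, Prod.mk.injEq] at h3
    obtain ⟨rfl, h4⟩ := h3
    exact h4.symm
  · intro h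
    apply Subtype.ext
    ext x
    rw [mem_target, mem_target]
    refine exists_congr fun i => and_congr_right fun hi => ?_
    rw [place_inl, place_inl, h i hi]

/-- A blueprint for building `G`: its vertices are identified with some of `m + d` points, and every
edge either consists of `r` of the first `m` points together with all the last `d` points, or is
one of `l` surplus edges, each of which is split into `r` of the first `m` points and `d` other
points. -/
structure Blueprint (G : Hypergraph α) (m d r l : ℕ) where
  /-- the identification of the vertices -/
  pos : G.vertexSet → Fin m ⊕ Fin d
  /-- the part of a surplus edge which is drawn at random -/
  U : Fin l → Set.powersetCard (Fin m) r
  /-- the part of a surplus edge which is selected by the player -/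
  V : Fin l → Set.powersetCard (Fin m ⊕ Fin d) d
  pos_injective : Function.Injective pos
  disjoint : ∀ i, ∀ x ∈ (U i).1, Sum.inl x ∉ (V i).1
  edge : ∀ e ∈ G.edgeSet,
    (∃ f : Set.powersetCard (Fin m) r, ∀ x,
      (∃ v : G.vertexSet, v.1 ∈ e ∧ pos v = x) ↔ (∃ y ∈ f.1, .inl y = x) ∨ ∃ j, .inr j = x) ∨
    ∃ i, ∀ x,
      (∃ v : G.vertexSet, v.1 ∈ e ∧ pos v = x) ↔ (∃ y ∈ (U i).1, .inl y = x) ∨ x ∈ (V i).1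

/-- The answer to a surplus edge. -/
def answer {G : Hypergraph α} (B : Blueprint G m d r l) (ψ : (Fin m × Fin w) ⊕ Fin d ↪ Fin n)
    (i : Fin l) (φ : Fin m → Fin w) : Set.powersetCard (Fin n) d :=
  Set.powersetCard.map d (place ψ φ) (B.V i)

/-- The answer to the rounds of the first kind. -/
def baseAnswer (ψ : (Fin m × Fin w) ⊕ Fin d ↪ Fin n) : Set.powersetCard (Fin n) d :=
  Set.powersetCard.ofFinEmb d (Fin n) (Function.Embedding.inr.trans ψ)

theorem containsCopy_built {G : Hypergraph α} (B : Blueprint G m (s - r) r l)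
    (ψ : (Fin m × Fin w) ⊕ Fin (s - r) ↪ Fin n) (φ : Fin m → Fin w) (past : List (Round r s n))
    (h₁ : ∀ f, (target ψ B.U (.inl f) φ, baseAnswer ψ) ∈ past)
    (h₂ : ∀ i, (target ψ B.U (.inr i) φ, answer B ψ i φ) ∈ past) :
    containsCopy G n (built past) := by
  -- Both kinds of edge are handled together: `Q` describes the points supplied by the player, and
  -- its disjointness from the drawn part makes the multiset edge non-degenerate.
  have key : ∀ e ∈ G.edgeSet, ∀ (ρ : Role m r l) (W : Set.powersetCard (Fin n) (s - r))
      (Q : Fin m ⊕ Fin (s - r) → Prop), (target ψ B.U ρ φ, W) ∈ past →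
      (∀ x, x ∈ W.1 ↔ ∃ y, Q y ∧ place ψ φ y = x) → (∀ y ∈ support B.U ρ, ¬ Q (.inl y)) →
      (∀ x, (∃ v : G.vertexSet, v.1 ∈ e ∧ B.pos v = x) ↔
        (∃ y ∈ support B.U ρ, .inl y = x) ∨ Q x) →
      ∃ F ∈ built past, F.Nodup ∧ ∀ x : Fin n, x ∈ F ↔
        ∃ v : G.vertexSet, v.1 ∈ e ∧ place ψ φ (B.pos v) = x := by
    intro e _ ρ W Q hmem hW hdis hQ
    refine ⟨(target ψ B.U ρ φ).1.val + W.1.val, ?_, ?_, fun x => ?_⟩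
    · exact Multiset.mem_coe.2 (List.mem_map.2 ⟨_, hmem, rfl⟩)
    · rw [Multiset.nodup_add]
      refine ⟨Finset.nodup _, Finset.nodup _, ?_⟩
      rw [Finset.disjoint_val, Finset.disjoint_left]
      intro x hx hx'
      obtain ⟨i, hi, rfl⟩ := mem_target.1 hx
      obtain ⟨y, hy, hyx⟩ := (hW _).1 hx'
      rw [(place ψ φ).injective hyx] at hy
      exact hdis i hi hy
    · rw [Multiset.mem_add, Finset.mem_val, Finset.mem_val, mem_target, hW]
      constructor
      · rintro (⟨i, hi, rfl⟩ | ⟨y, hy, rfl⟩)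
        · obtain ⟨v, hv, hvx⟩ := (hQ (.inl i)).2 (.inl ⟨i, hi, rfl⟩)
          exact ⟨v, hv, by rw [hvx]⟩
        · obtain ⟨v, hv, hvx⟩ := (hQ y).2 (.inr hy)
          exact ⟨v, hv, by rw [hvx]⟩
      · rintro ⟨v, hv, rfl⟩
        rcases (hQ (B.pos v)).1 ⟨v, hv, rfl⟩ with ⟨i, hi, hix⟩ | h
        · exact .inl ⟨i, hi, by rw [hix]⟩
        · exact .inr ⟨_, h, rfl⟩
  refine ⟨fun v => place ψ φ (B.pos v), (place ψ φ).injective.comp B.pos_injective,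
    fun e he => ?_⟩
  rcases B.edge e he with ⟨f, hf⟩ | ⟨i, hi⟩
  · refine key e he (.inl f) _ (fun x => ∃ j, .inr j = x) (h₁ f) (fun x => ?_) (by simp) hf
    rw [baseAnswer, Set.powersetCard.mem_coe_iff, Set.powersetCard.mem_ofFinEmb_iff_mem_range]
    simp [place_inr]
  · refine key e he (.inr i) _ (fun x => x ∈ (B.V i).1) (h₂ i) (fun x => ?_) (B.disjoint i) hi
    simp [answer]

theorem optimalTime_le {G : Hypergraph α} (B : Blueprint G m (s - r) r l) {q : ℝ} {T₁ T₂ : ℕ}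
    (hr : r ≤ n) (hs : s ≤ n) (hn : m * w + (s - r) ≤ n) (hw : 0 < w)
    (h₁ : 0 < hitProb (n.choose r) T₁) (h₂ : 0 < hitProb (n.choose r) T₂)
    (hq : 4 * varianceBound m r l w (hitProb (n.choose r) T₁) (hitProb (n.choose r) T₂) +
      2 * conflictBound m r l w (hitProb (n.choose r) T₁) ≤ 1 - q) :
    optimalTime r s (containsCopy G) q n ≤ ((m.choose r * T₁ + l * T₂ : ℕ) : ℕ∞) := by
  have := powersetCard_nonempty hr
  obtain ⟨ψ⟩ : Nonempty ((Fin m × Fin w) ⊕ Fin (s - r) ↪ Fin n) :=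
    Function.Embedding.nonempty_of_card_le (by simpa using hn)
  obtain ⟨e, he⟩ := exists_schedule m r l T₁ T₂
  rw [optimalTime, dif_pos ⟨hr, hs⟩]
  refine (iInf_le _ _).trans (strategyTime_pure_le (containsCopy G) hr
    (player e (target ψ B.U) (answer B ψ) (baseAnswer ψ)) _ q
    (fun ω => Good (target ψ B.U) fun ρ j => ω (e.symm ⟨ρ, j⟩)) (fun ω hω => ?_) ?_)
  · obtain ⟨φ, h1, h2⟩ := mem_history_player e he _ (answer B ψ) (baseAnswer ψ) ω hω
    exact containsCopy_built B ψ φ _ h1 h2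
  · refine le_trans (le_of_eq (expect_schedule e fun ω =>
      if Good (target ψ B.U) ω then (0 : ℝ) else 1)) ?_
    rw [← card_powersetCard_fin] at h₁ h₂ hq
    exact (expect_not_good (target_eq_iff ψ B.U) hw h₁ h₂).trans hq

end Placement

/-! ### Blueprints from a set of maximum degree. -/

section Graph

open scoped Classical

variable {α : Type*} {m d r s : ℕ}

theorem exists_left_part {P : Finset (Fin m ⊕ Fin d)} (hP : P.card = r + d)
    (h : ∀ j, Sum.inr j ∈ P) : ∃ f : Set.powersetCard (Fin m) r,
      ∀ x, x ∈ P ↔ (∃ y ∈ f.1, .inl y = x) ∨ ∃ j, .inr j = x := by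
  have h1 : P.toRight = Finset.univ := by ext j; simpa using h j
  have h2 := P.card_toLeft_add_card_toRight
  rw [h1, Finset.card_univ, Fintype.card_fin, hP] at h2
  refine ⟨⟨P.toLeft, show P.toLeft.card = r by omega⟩, ?_⟩
  rintro (i | j)
  · simp
  · simp [h]

/-- Only `d` points lie on the right, so at least `r` of the `r + d` points lie on the left and can
serve as the drawn part. -/
theorem exists_split {P : Finset (Fin m ⊕ Fin d)} (hP : P.card = r + d) :
    ∃ (U : Set.powersetCard (Fin m) r) (V : Set.powersetCard (Fin m ⊕ Fin d) d),
      (∀ x ∈ U.1, Sum.inl x ∉ V.1) ∧ ∀ x, x ∈ P ↔ (∃ y ∈ U.1, .inl y = x) ∨ x ∈ V.1 := by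
  have h2 := P.card_toLeft_add_card_toRight
  have h3 : P.toRight.card ≤ d := by simpa using Finset.card_le_univ P.toRight
  obtain ⟨U, hU, hUc⟩ := Finset.exists_subset_card_eq (s := P.toLeft) (n := r) (by omega)
  have hsub : U.map Function.Embedding.inl ⊆ P := by
    intro x hx
    obtain ⟨y, hy, rfl⟩ := Finset.mem_map.1 hx
    exact Finset.mem_toLeft.1 (hU hy)
  refine ⟨⟨U, hUc⟩, ⟨P \ U.map Function.Embedding.inl, ?_⟩, ?_, ?_⟩
  · change (P \ U.map Function.Embedding.inl).card = d
    rw [Finset.card_sdiff_of_subset hsub, Finset.card_map, hP, hUc]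
    omega
  · intro x hx
    simpa using fun _ => hx
  · intro x
    constructor
    · intro hx
      by_cases h : x ∈ U.map Function.Embedding.inl
      · obtain ⟨y, hy, rfl⟩ := Finset.mem_map.1 h
        exact .inl ⟨y, hy, rfl⟩
      · exact .inr (Finset.mem_sdiff.2 ⟨hx, h⟩)
    · rintro (⟨y, hy, rfl⟩ | h)
      · exact hsub (Finset.mem_map_of_mem _ hy)
      · exact (Finset.mem_sdiff.1 h).1

theorem edgeSet_finite {G : Hypergraph α} (hG : G.vertexSet.Finite) : G.edgeSet.Finite :=
  hG.finite_subsets.subset fun _ he => G.subset_vertexSet_of_mem_edgeSet' he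

theorem exists_maxDegree {G : Hypergraph α} (hG : G.vertexSet.Finite)
    (hd : d ≤ G.vertexSet.ncard) :
    ∃ D ⊆ G.vertexSet, D.ncard = d ∧ maxDegree G d = {e ∈ G.edgeSet | D ⊆ e}.ncard := by
  refine Nat.sSup_mem (s := {m | ∃ D ⊆ G.vertexSet, D.ncard = d ∧
    m = {e ∈ G.edgeSet | D ⊆ e}.ncard}) ?_ ⟨G.edgeSet.ncard, ?_⟩
  · obtain ⟨D, hD, hDc⟩ := Set.exists_subset_card_eq hd
    exact ⟨_, D, hD, hDc, rfl⟩
  · rintro _ ⟨D, -, -, rfl⟩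
    exact Set.ncard_le_ncard (Set.sep_subset _ _) (edgeSet_finite hG)

theorem exists_position {X D : Set α} (hX : X.Finite) (hD : D ⊆ X) (hDc : D.ncard = d)
    (hXc : X.ncard ≤ m + d) :
    ∃ pos : X → Fin m ⊕ Fin d, Function.Injective pos ∧
      ∀ j, ∃ v : X, v.1 ∈ D ∧ pos v = .inr j := by
  have hDf := hX.subset hD
  have := hDf.to_subtype
  have := (hX.sdiff (t := D)).to_subtype
  let e : D ≃ Fin d := Finite.equivFinOfCardEq hDc
  have h1 : (X \ D).ncard ≤ m := by
    rw [Set.ncard_sdiff hD hDf]; omega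
  let g : (X \ D : Set α) → Fin m :=
    fun x => (Fin.castLE h1) ((Finite.equivFinOfCardEq (α := (X \ D : Set α)) rfl) x)
  have hg : Function.Injective g := (Fin.castLE_injective h1).comp (Equiv.injective _)
  refine ⟨fun v => if h : v.1 ∈ D then .inr (e ⟨v, h⟩) else .inl (g ⟨v, v.2, h⟩), ?_, fun j => ?_⟩
  · intro v v' h
    dsimp only at h
    split_ifs at h with h1 h2 h2
    · have := e.injective (Sum.inr.inj h)
      exact Subtype.ext (Subtype.mk.inj this)
    · have := hg (Sum.inl.inj h)
      exact Subtype.ext (Subtype.mk.inj this)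
  · refine ⟨⟨e.symm j, hD (e.symm j).2⟩, (e.symm j).2, ?_⟩
    simp

/-- A set `D` attaining `maxDegree` goes onto the `s - r` common points. The edges not containing
`D` then number exactly `surplus G r s` and are split arbitrarily. -/
theorem exists_blueprint {G : Hypergraph α} (hrs : r < s) (hG : IsSGraph G s) {k : ℕ}
    (hk : s < k) (hGk : G.vertexSet.ncard ≤ k) :
    Nonempty (Blueprint G (k - s + r) (s - r) r (surplus G r s)) := by
  obtain ⟨hV, hE⟩ := hG
  have hVfin := hV.to_subtype
  have hle : G.vertexSet.ncard ≤ (k - s + r) + (s - r) := by omega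
  have hcard : ∀ pos : G.vertexSet → Fin (k - s + r) ⊕ Fin (s - r), Function.Injective pos →
      ∀ e ∈ G.edgeSet, ∃ P : Finset (Fin (k - s + r) ⊕ Fin (s - r)), P.card = r + (s - r) ∧
        ∀ x, x ∈ P ↔ ∃ v : G.vertexSet, v.1 ∈ e ∧ pos v = x := by
    intro pos hpos e he
    have hsub := G.subset_vertexSet_of_mem_edgeSet' he
    have hfin : (pos '' {v | v.1 ∈ e}).Finite := Set.toFinite _
    refine ⟨hfin.toFinset, ?_, fun x => by simp⟩
    rw [← Set.ncard_eq_toFinset_card _ hfin, Set.ncard_image_of_injective _ hpos,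
      ← Set.ncard_image_of_injective _ Subtype.val_injective]
    have : Subtype.val '' {v : G.vertexSet | v.1 ∈ e} = e := by
      ext x
      simpa using fun hx => hsub hx
    rw [this, hE e he]
    omega
  by_cases hd : s - r ≤ G.vertexSet.ncard
  · obtain ⟨D, hDV, hDc, hmax⟩ := exists_maxDegree hV hd
    obtain ⟨pos, hpos, hposD⟩ := exists_position hV hDV hDc hle
    choose P hPc hP using hcard pos hpos
    have hEf := edgeSet_finite hV
    have hl : {e ∈ G.edgeSet | ¬ D ⊆ e}.ncard = surplus G r s := by
      rw [surplus, hmax, ← Set.ncard_sdiff (Set.sep_subset _ _)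
        (hEf.subset (Set.sep_subset _ _))]
      congr 1
      ext e
      simp only [Set.mem_ofPred_eq, Set.mem_sdiff]
      tauto
    have hfin : Finite {e ∈ G.edgeSet | ¬ D ⊆ e} := (hEf.subset (Set.sep_subset _ _)).to_subtype
    let E : {e ∈ G.edgeSet | ¬ D ⊆ e} ≃ Fin (surplus G r s) := Finite.equivFinOfCardEq hl
    choose U V hUV hsplit using fun i => exists_split (hPc (E.symm i).1 (E.symm i).2.1)
    refine ⟨⟨pos, U, V, hpos, hUV, fun e he => ?_⟩⟩
    by_cases hDe : D ⊆ e
    · left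
      obtain ⟨f, hf⟩ := exists_left_part (hPc e he) fun j => by
        obtain ⟨v, hv, hvj⟩ := hposD j
        exact (hP e he _).2 ⟨v, hDe hv, hvj⟩
      exact ⟨f, fun x => (hP e he x).symm.trans (hf x)⟩
    · right
      refine ⟨E ⟨e, he, hDe⟩, fun x => ?_⟩
      rw [← hsplit, hP]
      simp
  · obtain ⟨pos⟩ : Nonempty (G.vertexSet ↪ Fin (k - s + r) ⊕ Fin (s - r)) := by
      have := Fintype.ofFinite G.vertexSet
      refine Function.Embedding.nonempty_of_card_le ?_
      rw [← Nat.card_eq_fintype_card]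
      simpa using hle
    -- With fewer than `s - r` vertices there are no edges, so `U` and `V` are mere fillers.
    obtain ⟨U⟩ := powersetCard_nonempty (n := k - s + r) (r := r) (by omega)
    have hempty : ∀ e, e ∉ G.edgeSet := fun e he => by
      have := Set.ncard_le_ncard (G.subset_vertexSet_of_mem_edgeSet' he) hV
      rw [hE e he] at this
      omega
    let V : Set.powersetCard (Fin (k - s + r) ⊕ Fin (s - r)) (s - r) :=
      Set.powersetCard.ofFinEmb _ _ Function.Embedding.inr
    refine ⟨⟨pos, fun _ => U, fun _ => V, pos.injective, fun i x _ hx => ?_,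
      fun e he => absurd he (hempty e)⟩⟩
    rw [Set.powersetCard.mem_coe_iff, Set.powersetCard.mem_ofFinEmb_iff_mem_range] at hx
    simp at hx

end Graph

/-! ### Orders of magnitude and the resulting bound on the exponent. -/

section Asymptotics

open Asymptotics

/-- `u` grows like the power `n ^ x`. -/
def HasOrder (u : ℕ → ℝ) (x : ℝ) : Prop := u =Θ[atTop] fun n : ℕ => (n : ℝ) ^ x

theorem HasOrder.mul {u v : ℕ → ℝ} {x y : ℝ} (hu : HasOrder u x) (hv : HasOrder v y) :
    HasOrder (fun n => u n * v n) (x + y) := by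
  refine (IsTheta.mul hu hv).trans_eventuallyEq ?_
  filter_upwards [eventually_gt_atTop 0] with n hn
  rw [Real.rpow_add (by exact_mod_cast hn)]

theorem HasOrder.inv {u : ℕ → ℝ} {x : ℝ} (hu : HasOrder u x) :
    HasOrder (fun n => (u n)⁻¹) (-x) := by
  refine (IsTheta.inv hu).trans_eventuallyEq (Eventually.of_forall fun n => ?_)
  exact (Real.rpow_neg (Nat.cast_nonneg n) x).symm

theorem HasOrder.pow {u : ℕ → ℝ} {x : ℝ} (hu : HasOrder u x) (k : ℕ) :
    HasOrder (fun n => u n ^ k) (x * k) := by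
  refine (IsTheta.pow hu k).trans_eventuallyEq (Eventually.of_forall fun n => ?_)
  exact (Real.rpow_mul_natCast (Nat.cast_nonneg n) x k).symm

theorem HasOrder.tendsto_zero {u : ℕ → ℝ} {x : ℝ} (hu : HasOrder u x) (hx : x < 0) :
    Tendsto u atTop (𝓝 0) := by
  refine (IsTheta.tendsto_zero_iff hu).2 ?_
  have := (tendsto_rpow_neg_atTop (neg_pos.2 hx)).comp (tendsto_natCast_atTop_atTop (R := ℝ))
  rw [neg_neg] at this
  exact this

theorem HasOrder.of_le {u v : ℕ → ℝ} {x C : ℝ} (hv : HasOrder v x)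
    (h₁ : ∀ᶠ n in atTop, 0 ≤ u n ∧ u n ≤ C * v n) (h₂ : ∀ᶠ n in atTop, 0 ≤ v n ∧ v n ≤ C * u n) :
    HasOrder u x := by
  refine IsTheta.trans ⟨IsBigO.of_bound C ?_, IsBigO.of_bound C ?_⟩ hv
  · filter_upwards [h₁, h₂] with n h1 h2
    rw [Real.norm_of_nonneg h1.1, Real.norm_of_nonneg h2.1]
    exact h1.2
  · filter_upwards [h₁, h₂] with n h1 h2
    rw [Real.norm_of_nonneg h1.1, Real.norm_of_nonneg h2.1]
    exact h2.2

theorem hasOrder_ceil {x : ℝ} (hx : 0 ≤ x) : HasOrder (fun n : ℕ => (⌈(n : ℝ) ^ x⌉₊ : ℝ)) x := by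
  refine HasOrder.of_le (C := 2) (isTheta_refl _ _) ?_ ?_ <;>
    filter_upwards [eventually_ge_atTop 1] with n hn <;>
    have h1 : 1 ≤ (n : ℝ) ^ x := Real.one_le_rpow (by exact_mod_cast hn) hx
  · exact ⟨Nat.cast_nonneg _, by linarith [Nat.ceil_lt_add_one (by linarith : 0 ≤ (n : ℝ) ^ x)]⟩
  · exact ⟨by linarith, by linarith [Nat.le_ceil ((n : ℝ) ^ x)]⟩

theorem hasOrder_choose (r : ℕ) : HasOrder (fun n : ℕ => (n.choose r : ℝ)) r := by
  have := isTheta_choose r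
  refine this.trans_eventuallyEq (Eventually.of_forall fun n => ?_)
  simp

/-- Since `a > 0`, the ratio of rounds to `C(n, r)` tends to zero, so eventually `le_hitProb`
applies and both bounds are linear in the ratio. -/
theorem hasOrder_hitProb {r : ℕ} {a : ℝ} (ha : 0 < a) (har : a ≤ r) :
    HasOrder (fun n => hitProb (n.choose r) ⌈(n : ℝ) ^ (r - a)⌉₊) (-a) := by
  have hp : HasOrder (fun n : ℕ => (⌈(n : ℝ) ^ (r - a)⌉₊ : ℝ) / (n.choose r : ℝ)) (-a) := by
    have := (hasOrder_ceil (sub_nonneg.2 har)).mul (hasOrder_choose r).inv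
    rwa [show (r : ℝ) - a + -r = -a by ring] at this
  have h1 : ∀ᶠ n : ℕ in atTop, (⌈(n : ℝ) ^ (r - a)⌉₊ : ℝ) / (n.choose r : ℝ) ≤ 1 :=
    (hp.tendsto_zero (by linarith)).eventually_le_const one_pos
  refine hp.of_le (C := 2) ?_ ?_ <;> filter_upwards [h1] with n hn
  · have h0 : (0 : ℝ) ≤ (⌈(n : ℝ) ^ (r - a)⌉₊ : ℝ) / (n.choose r : ℝ) := by positivity
    exact ⟨hitProb_nonneg _ _, by linarith [hitProb_le (n.choose r) ⌈(n : ℝ) ^ (r - a)⌉₊]⟩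
  · exact ⟨by positivity, by linarith [le_hitProb hn]⟩

theorem hasOrder_blockSize {m : ℕ} (hm : 0 < m) (d : ℕ) :
    HasOrder (fun n => (((n - d) / m : ℕ) : ℝ)) 1 := by
  have h : HasOrder (fun n : ℕ => (n : ℝ)) 1 := by
    unfold HasOrder
    simp only [Real.rpow_one]
    exact isTheta_refl _ _
  refine h.of_le (C := 2 * m) ?_ ?_ <;>
    filter_upwards [eventually_ge_atTop (2 * (d + m))] with n hn
  · refine ⟨Nat.cast_nonneg _, ?_⟩
    have : (n - d) / m ≤ 2 * m * n :=
      (Nat.div_le_self _ _).trans ((Nat.sub_le _ _).trans (Nat.le_mul_of_pos_left _ (by omega)))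
    exact_mod_cast this
  · refine ⟨Nat.cast_nonneg _, ?_⟩
    have h1 := Nat.div_add_mod (n - d) m
    have h2 := Nat.mod_lt (n - d) hm
    have : n ≤ 2 * (m * ((n - d) / m)) := by omega
    rw [← mul_assoc] at this
    exact_mod_cast this

theorem HasOrder.eventually_pos {u : ℕ → ℝ} {x : ℝ} (hu : HasOrder u x) (h : ∀ n, 0 ≤ u n) :
    ∀ᶠ n in atTop, 0 < u n := by
  filter_upwards [hu.eq_zero_iff, eventually_gt_atTop 0] with n hn hn0
  refine lt_of_le_of_ne (h n) fun h0 => ?_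
  have := hn.1 h0.symm
  have h2 : 0 < (n : ℝ) ^ x := Real.rpow_pos_of_pos (by exact_mod_cast hn0) _
  linarith

variable {m r l : ℕ} {a b : ℝ} {w q₁ q₂ : ℕ → ℝ}

theorem tendsto_varianceBound (hw : HasOrder w 1) (h₁ : HasOrder q₁ (-a)) (h₂ : HasOrder q₂ (-b))
    (h : ∀ j, r ≤ j → j ≤ m → a * j.choose r + b * l < j) :
    Tendsto (fun n => varianceBound m r l (w n) (q₁ n) (q₂ n)) atTop (𝓝 0) := by
  unfold varianceBound
  rw [show 𝓝 (0 : ℝ) = 𝓝 (∑ _J : Finset (Fin m), (0 : ℝ)) by simp]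
  apply tendsto_finsetSum
  intro J _
  split_ifs with hJ
  · refine HasOrder.tendsto_zero
      (((hw.pow J.card).mul (h₁.pow (J.card.choose r))).mul (h₂.pow l)).inv ?_
    have := h J.card hJ (by simpa using Finset.card_le_univ J)
    linarith
  · exact tendsto_const_nhds

theorem tendsto_conflictBound (hw : HasOrder w 1) (h₁ : HasOrder q₁ (-a))
    (h : l = 0 ∨ ∀ j, r ≤ j → j < m → (m : ℝ) - j < a * (m.choose r - j.choose r)) :
    Tendsto (fun n => conflictBound m r l (w n) (q₁ n)) atTop (𝓝 0) := by
  unfold conflictBound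
  rcases h with rfl | h
  · simp
  rw [show 𝓝 (0 : ℝ) = 𝓝 (l * ∑ _J : Finset (Fin m), (0 : ℝ)) by simp]
  apply Tendsto.const_mul
  apply tendsto_finsetSum
  intro J _
  split_ifs with hJ
  · refine HasOrder.tendsto_zero
      ((hw.pow (m - J.card)).mul (h₁.pow (m.choose r - J.card.choose r))) ?_
    have := h J.card hJ.1 hJ.2
    rw [Nat.cast_sub hJ.2.le, Nat.cast_sub (Nat.choose_le_choose r hJ.2.le)]
    linarith
  · exact tendsto_const_nhds

/-- Take `⌈n ^ (r - a)⌉` and `⌈n ^ (r - b)⌉` rounds per role: `h` kills the variance, `h'` kills the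
conflicts, and the strict inequalities on `c` absorb the constant factors in the total time. -/
theorem exponentAt_le {α : Type*} {G : Hypergraph α} {s : ℕ} (B : Blueprint G m (s - r) r l)
    (hm : 0 < m) (ha : 0 < a) (har : a ≤ r) (hb : 0 < b) (hbr : b ≤ r)
    (h : ∀ j, r ≤ j → j ≤ m → a * j.choose r + b * l < j)
    (h' : l = 0 ∨ ∀ j, r ≤ j → j < m → (m : ℝ) - j < a * (m.choose r - j.choose r))
    {c : ℝ} (hac : r - a < c) (hbc : r - b < c) {q : ℝ} (hq : q < 1) :
    exponentAt r s (containsCopy G) q ≤ (c : EReal) := by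
  have hw := hasOrder_blockSize hm (s - r)
  have h₁ := hasOrder_hitProb ha har
  have h₂ := hasOrder_hitProb hb hbr
  have hbound : ∀ᶠ n : ℕ in atTop,
      4 * varianceBound m r l ((n - (s - r)) / m : ℕ) (hitProb (n.choose r) ⌈(n : ℝ) ^ (r - a)⌉₊)
        (hitProb (n.choose r) ⌈(n : ℝ) ^ (r - b)⌉₊) +
      2 * conflictBound m r l ((n - (s - r)) / m : ℕ)
        (hitProb (n.choose r) ⌈(n : ℝ) ^ (r - a)⌉₊) ≤ 1 - q := by
    have := ((tendsto_varianceBound hw h₁ h₂ h).const_mul 4).add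
      ((tendsto_conflictBound hw h₁ h').const_mul 2)
    simp only [mul_zero, add_zero] at this
    exact this.eventually_le_const (by linarith)
  have htime : ∀ᶠ n : ℕ in atTop,
      ((m.choose r * ⌈(n : ℝ) ^ (r - a)⌉₊ + l * ⌈(n : ℝ) ^ (r - b)⌉₊ : ℕ) : ℝ) ≤ (n : ℝ) ^ c := by
    have hpow : ∀ x : ℝ, 0 ≤ x → x < c →
        (fun n : ℕ => (⌈(n : ℝ) ^ x⌉₊ : ℝ)) =o[atTop] fun n : ℕ => (n : ℝ) ^ c := by
      intro x hx hxc
      refine isLittleO_of_tendsto' ?_ (((hasOrder_ceil hx).mul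
        (HasOrder.inv (isTheta_refl _ _))).tendsto_zero (by linarith : x + -c < 0))
      filter_upwards [eventually_gt_atTop 0] with n hn h0
      exact absurd h0 (Real.rpow_pos_of_pos (by exact_mod_cast hn) c).ne'
    have := ((hpow _ (sub_nonneg.2 har) hac).const_mul_left (m.choose r : ℝ)).add
      ((hpow _ (sub_nonneg.2 hbr) hbc).const_mul_left (l : ℝ))
    filter_upwards [this.bound one_pos] with n hn
    rw [one_mul, Real.norm_of_nonneg (by positivity), Real.norm_of_nonneg (by positivity)] at hn
    exact_mod_cast hn
  refine limsup_le_of_le (by isBoundedDefault) ?_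
  filter_upwards [hbound, htime, h₁.eventually_pos fun n => hitProb_nonneg _ _,
    h₂.eventually_pos fun n => hitProb_nonneg _ _, hw.eventually_pos fun n => Nat.cast_nonneg _,
    eventually_ge_atTop (r + s + 2)] with n hn ht hp₁ hp₂ hwn hns
  have hfit : m * ((n - (s - r)) / m) + (s - r) ≤ n := by
    have := Nat.mul_div_le (n - (s - r)) m
    omega
  have hopt := optimalTime_le B (by omega) (by omega) hfit (by exact_mod_cast hwn) hp₁ hp₂ hn
  have hn1 : (1 : ℝ) < n := by exact_mod_cast (by omega : 1 < n)
  have hlog : 0 < Real.log n := Real.log_pos hn1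
  have h3 : (optimalTime r s (containsCopy G) q n : ℝ≥0∞) ≤ ENNReal.ofReal ((n : ℝ) ^ c) := by
    have h4 : (optimalTime r s (containsCopy G) q n : ℝ≥0∞) ≤
        ((m.choose r * ⌈(n : ℝ) ^ (r - a)⌉₊ + l * ⌈(n : ℝ) ^ (r - b)⌉₊ : ℕ) : ℝ≥0∞) := by
      exact_mod_cast hopt
    refine h4.trans ?_
    rw [← ENNReal.ofReal_natCast]
    exact ENNReal.ofReal_le_ofReal ht
  rw [EReal.div_le_iff_le_mul (by exact_mod_cast hlog) (EReal.coe_ne_top _)]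
  refine (ENNReal.log_monotone h3).trans ?_
  rw [ENNReal.log_ofReal_of_pos (by positivity), Real.log_rpow (by linarith)]
  rw [← EReal.coe_mul]
  exact_mod_cast (mul_comm _ _).le

end Asymptotics

/-! ### Convexity of binomial coefficients and the choice of exponents. -/

section Exponents

/-- By Pascal's rule, each of the `i` increments leading up from `C(r + 1, r + 1) = 1` is at most
`C(r + 1 + i, r)`. -/
theorem choose_succ_le_one_add (r i : ℕ) :
    (r + 1 + i).choose (r + 1) ≤ 1 + i * (r + 1 + i).choose r := by
  induction i with
  | zero => simp
  | succ i ih =>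
    have h1 : (r + 1 + i).choose r ≤ (r + 1 + (i + 1)).choose r :=
      Nat.choose_le_choose r (by omega)
    have h2 : (r + 1 + (i + 1)).choose (r + 1) =
        (r + 1 + i).choose r + (r + 1 + i).choose (r + 1) := Nat.choose_succ_succ _ _
    nlinarith

theorem choose_add_mul_le (r j i : ℕ) :
    j.choose (r + 1) + i * j.choose r ≤ (j + i).choose (r + 1) := by
  induction i with
  | zero => simp
  | succ i ih =>
    have h1 : j.choose r ≤ (j + i).choose r := Nat.choose_le_choose r (by omega)
    have h2 : (j + (i + 1)).choose (r + 1) =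
        (j + i).choose r + (j + i).choose (r + 1) := Nat.choose_succ_succ _ _
    nlinarith

/-- Convexity of binomial coefficients between `r` and `m`. -/
theorem choose_chord {r j m : ℕ} (hr : 0 < r) (hrj : r ≤ j) (hjm : j ≤ m) :
    ((m : ℝ) - r) * j.choose r ≤ (m - j) + (j - r) * m.choose r := by
  obtain ⟨r, rfl⟩ := Nat.exists_eq_succ_of_ne_zero hr.ne'
  obtain ⟨i, rfl⟩ := Nat.exists_eq_add_of_le hrj
  obtain ⟨i', rfl⟩ := Nat.exists_eq_add_of_le hjm
  have h1 : ((r + 1 + i).choose (r + 1) : ℝ) ≤ 1 + i * (r + 1 + i).choose r := by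
    exact_mod_cast choose_succ_le_one_add r i
  have h2 : ((r + 1 + i).choose (r + 1) : ℝ) + i' * (r + 1 + i).choose r ≤
      (r + 1 + i + i').choose (r + 1) := by
    exact_mod_cast choose_add_mul_le r (r + 1 + i) i'
  simp only [Nat.succ_eq_add_one]
  push_cast
  -- Weighting the two slope bounds at `j` by the lengths `i'` and `i` cancels the common slope
  -- `C(j, r)`.
  have h3 := mul_le_mul_of_nonneg_left h1 (Nat.cast_nonneg (α := ℝ) i')
  have h4 := mul_le_mul_of_nonneg_left h2 (Nat.cast_nonneg (α := ℝ) i)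
  nlinarith

theorem choose_lt_choose_of_lt {r j m : ℕ} (hr : 0 < r) (hrj : r ≤ j) (hjm : j < m) :
    j.choose r < m.choose r := by
  obtain ⟨r, rfl⟩ := Nat.exists_eq_succ_of_ne_zero hr.ne'
  obtain ⟨i, rfl⟩ := Nat.exists_eq_add_of_lt hjm
  have h1 := choose_add_mul_le r j (i + 1)
  have h2 : 0 < j.choose r := Nat.choose_pos (by omega)
  rw [← add_assoc] at h1
  simp only [Nat.succ_eq_add_one]
  nlinarith

theorem tau_le_of_blueprint {α : Type*} {G : Hypergraph α} {m r s l : ℕ}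
    (B : Blueprint G m (s - r) r l) (hr : 0 < r) (hm : r < m)
    (h : (m : ℝ) * (1 + l) ≤ r * (m.choose r + l)) :
    tau r s (containsCopy G) ≤ (((r : ℝ) - m / (m.choose r + l) : ℝ) : EReal) := by
  have hC : (1 : ℝ) ≤ m.choose r := by exact_mod_cast Nat.choose_pos hm.le
  have hm0 : (0 : ℝ) < m := by exact_mod_cast (by omega : 0 < m)
  have hl0 : (0 : ℝ) ≤ l := Nat.cast_nonneg l
  have hCl : (0 : ℝ) < m.choose r + l := by linarith
  have hmr : (0 : ℝ) < (m : ℝ) - r := sub_pos.2 (by exact_mod_cast hm)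
  set θ : ℝ := m / (m.choose r + l) with hθ
  have hθ0 : 0 < θ := by positivity
  have hθm : θ * (m.choose r + l) = m := div_mul_cancel₀ _ hCl.ne'
  have hθr : θ * (1 + l) ≤ r := by
    rw [hθ, div_mul_eq_mul_div, div_le_iff₀ hCl]
    exact h
  -- The left side is convex in `j` and the right side linear, so the ends suffice: `hθr` is the
  -- case `j = r`, `hθm` the case `j = m`.
  have hf : ∀ j, r ≤ j → j ≤ m → θ * (j.choose r + l) ≤ j := by
    intro j hj hj'
    have h1 := mul_le_mul_of_nonneg_left (choose_chord hr hj hj') hθ0.le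
    have h2 : (0 : ℝ) ≤ (m : ℝ) - j := sub_nonneg.2 (by exact_mod_cast hj')
    have h3 := mul_le_mul_of_nonneg_left hθr h2
    have h4 : ((j : ℝ) - r) * (θ * (m.choose r + l)) = (j - r) * m := by rw [hθm]
    have h5 : ((m : ℝ) - r) * (θ * (j.choose r + l)) ≤ (m - r) * j := by nlinarith
    exact le_of_mul_le_mul_left h5 hmr
  refine le_of_tendsto (tendsto_tau r s (containsCopy G)) ?_
  filter_upwards [self_mem_nhdsWithin] with q hq
  refine EReal.le_of_forall_lt_iff_le.1 fun z hz => ?_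
  have hz' : (r : ℝ) - θ < z := by exact_mod_cast hz
  obtain ⟨ε, hε, hε₁, hε₂⟩ : ∃ ε : ℝ, 0 < ε ∧ ε < z - (r - θ) ∧ ε ≤ θ / 2 :=
    ⟨min ((z - (r - θ)) / 2) (θ / 2), lt_min (by linarith) (by linarith),
      (min_le_left _ _).trans_lt (by linarith), min_le_right _ _⟩
  rcases Nat.eq_zero_or_pos l with rfl | hl
  · simp only [Nat.cast_zero, add_zero, mul_one] at hf hθr
    refine exponentAt_le B (a := θ - ε) (b := θ - ε) (by omega) (by linarith) (by linarith)
      (by linarith) (by linarith) (fun j hj hj' => ?_) (.inl rfl) (by linarith) (by linarith) hq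
    have h1 := hf j hj hj'
    have h2 : (0 : ℝ) < j.choose r := by exact_mod_cast Nat.choose_pos hj
    have h3 := mul_pos hε h2
    simp only [Nat.cast_zero, mul_zero, add_zero]
    linarith
  · have hl1 : (1 : ℝ) ≤ l := by exact_mod_cast hl
    have hθ2 : θ * 2 ≤ r := le_trans (by gcongr; linarith) hθr
    -- Small enough that `δ * C(j, r) < ε ≤ ε * l`, so raising `a` by `δ` is outweighed by lowering
    -- `b` by `ε`. The raise makes the conflict inequality, which at `θ` follows from `hf` and
    -- `hθm`, strict.
    set δ : ℝ := ε / (m.choose r + 1) with hδ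
    have hδ0 : 0 < δ := by positivity
    have hδε : δ * (m.choose r + 1) = ε := div_mul_cancel₀ _ (by positivity)
    have hδle : δ ≤ ε := by nlinarith
    refine exponentAt_le B (a := θ + δ) (b := θ - ε) (by omega) (by linarith) (by linarith)
      (by linarith) (by linarith) (fun j hj hj' => ?_) (.inr fun j hj hj' => ?_) (by linarith)
      (by linarith) hq
    · have h1 := hf j hj hj'
      have h2 : (j.choose r : ℝ) ≤ m.choose r := by exact_mod_cast Nat.choose_le_choose r hj'
      have h3 := mul_le_mul_of_nonneg_left h2 hδ0.le
      have h4 := mul_le_mul_of_nonneg_left hl1 hε.le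
      nlinarith
    · have h1 := hf j hj hj'.le
      have h2 : (0 : ℝ) < (m.choose r : ℝ) - j.choose r :=
        sub_pos.2 (by exact_mod_cast choose_lt_choose_of_lt hr hj hj')
      have h3 := mul_pos hδ0 h2
      nlinarith

theorem choose_two_le_choose (y r : ℕ) : (y + 2).choose 2 ≤ (y + (r + 2)).choose (r + 2) := by
  induction r with
  | zero => simp
  | succ r ih =>
    have h : (y + (r + 1 + 2)).choose (r + 1 + 2) =
        (y + (r + 2)).choose (r + 2) + (y + (r + 2)).choose (r + 2 + 1) := Nat.choose_succ_succ _ _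
    omega

/-- It suffices that `y ^ 2 ≤ r * C(y + r, r) - (y + r)`. Since `r ≥ 2`, the binomial is at least
`C(y + 2, 2)`, which is already quadratic in `y` with a sufficient constant. -/
theorem excessCondition_of_le {r s l y : ℕ} (hr : 2 ≤ r) (hy : 0 < y) (hl : l ≤ y) :
    ExcessCondition r s l (s + y) := by
  refine ⟨by omega, ?_⟩
  obtain ⟨t, rfl⟩ := Nat.exists_eq_add_of_le' hr
  have h1 : (((y + 2).choose 2 : ℕ) : ℝ) ≤ (y + (t + 2)).choose (t + 2) := by
    exact_mod_cast choose_two_le_choose y t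
  rw [Nat.cast_choose_two] at h1
  have hy' : (0 : ℝ) < y := by exact_mod_cast hy
  have hl' : (l : ℝ) ≤ y := by exact_mod_cast hl
  have e : s + y - s + (t + 2) = y + (t + 2) := by omega
  rw [e]
  push_cast at h1 ⊢
  rw [add_sub_cancel_left, le_div_iff₀ hy']
  have h2 := mul_le_mul_of_nonneg_left h1 (by positivity : (0 : ℝ) ≤ (t : ℝ) + 2)
  have h3 : (0 : ℝ) ≤ (t : ℝ) * y * y := by positivity
  have h4 : (0 : ℝ) ≤ (t : ℝ) * y := by positivity
  nlinarith

theorem tau_le_of_excessCondition {α : Type*} {G : Hypergraph α} {r s k : ℕ} (hr : 0 < r)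
    (hrs : r < s) (hG : IsSGraph G s) (hGk : G.vertexSet.ncard ≤ k)
    (hk : ExcessCondition r s (surplus G r s) k) :
    tau r s (containsCopy G) ≤ (((r : ℝ) - ((k : ℝ) - s + r) /
      (((k - s + r).choose r : ℝ) + (surplus G r s : ℝ)) : ℝ) : EReal) := by
  obtain ⟨hsk, hk⟩ := hk
  obtain ⟨B⟩ := exists_blueprint hrs hG hsk hGk
  have hks : (0 : ℝ) < (k : ℝ) - s := sub_pos.2 (by exact_mod_cast hsk)
  have hcast : ((k - s + r : ℕ) : ℝ) = (k : ℝ) - s + r := by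
    rw [Nat.cast_add, Nat.cast_sub hsk.le]
  have h := tau_le_of_blueprint B hr (by omega) ?_
  · rwa [hcast] at h
  -- With `m = k - s + r`, clearing the denominator `k - s = m - r` turns the excess condition into
  -- `m * (1 + l) ≤ r * (C(m, r) + l)`.
  · rw [le_div_iff₀ hks] at hk
    rw [hcast]
    linarith

end Exponents

end SemiRandom

theorem mainTheorem9 {α : Type*} (r s : ℕ) (hr : 2 ≤ r) (hrs : r < s)
    (G : Hypergraph α) (hG : SemiRandom.IsSGraph G s) :
    (∃ k : ℕ,
      IsLeast {k : ℕ | G.vertexSet.ncard ≤ k ∧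
        SemiRandom.ExcessCondition r s (SemiRandom.surplus G r s) k} k ∧
      SemiRandom.tau r s (SemiRandom.containsCopy G) ≤
        (((r : ℝ) - ((k : ℝ) - s + r) /
          (((k - s + r).choose r : ℝ) + (SemiRandom.surplus G r s : ℝ)) : ℝ) : EReal)) ∧
    SemiRandom.tau r s (SemiRandom.containsCopy G) < ((r : ℝ) : EReal) := by
  have hne : {k : ℕ | G.vertexSet.ncard ≤ k ∧
      SemiRandom.ExcessCondition r s (SemiRandom.surplus G r s) k}.Nonempty :=
    ⟨s + (G.vertexSet.ncard + SemiRandom.surplus G r s + 1), by omega,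
      SemiRandom.excessCondition_of_le hr (by omega) (by omega)⟩
  have hmem := Nat.sInf_mem hne
  have hle := SemiRandom.tau_le_of_excessCondition (by omega) hrs hG hmem.1 hmem.2
  refine ⟨⟨_, ⟨hmem, fun _ => Nat.sInf_le⟩, hle⟩, hle.trans_lt ?_⟩
  rw [EReal.coe_lt_coe_iff]
  refine sub_lt_self _ (div_pos ?_ ?_)
  · have : (s : ℝ) < _ := Nat.cast_lt.2 hmem.2.1
    have : (0 : ℝ) ≤ r := Nat.cast_nonneg r
    linarith
  · refine add_pos_of_pos_of_nonneg ?_ (Nat.cast_nonneg _)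
    exact_mod_cast Nat.choose_pos (by omega)
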